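/- \textbf{Theorem (asymptotic normality of the minimum dual $\phi$-divergence estimates).} \emph{Setting.} Let $\phi:\mathbb R\to[0,+\infty]$ be a closed convex function with $\phi(1)=0$ whose domain $\{\phi<\infty\}$ is an interval with endpoints $a_\phi<1<b_\phi$, strictly convex on $(a_\phi,b_\phi)$, with continuous derivatives up to order 4 there, with $\phi''(1)\neq 0$, and essentially smooth (i.e. $\phi'(x)\to-\infty$ as $x\downarrow a_\phi$ if $a_\phi>-\infty$, and $\phi'(x)\to+\infty$ as $x\uparrow b_\phi$ if $b_\phi<\infty$). Let $\Theta\subseteq\mathbb R^d$ and let $\{P_\theta;\theta\in\Theta\}$ be an identifiable family of probability measures on a measurable space $\mathcal X$ with densities $p_\theta\ge 0$ with respect to a $\sigma$-finite measure $\lambda$. Assume that the densities have a common support: for $\lambda$-a.e. $x$, either $p_\theta(x)>0$ for all $\theta\in\Theta$ or $p_\theta(x)=0$ for all $\theta\in\Theta$. Assume that for $\lambda$-a.e. $x$ in the support the ratios $p_\theta(x)/p_\alpha(x)$, $\theta,\alpha\in\Theta$, lie in $(a_\phi,b_\phi)$; that $\int|\phi'(p_\theta/p_\alpha)|\,dP_\theta<\infty$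 for all $\theta,\alpha\in\Theta$; and that $\theta\mapsto p_\theta(x)$ has continuous partial derivatives up to order 3 on the interior of $\Theta$ for $\lambda$-a.e. $x$. Let $\theta_T$ be an interior point of $\Theta$, let $X_1,X_2,\dots$ be i.i.d. with law $P_{\theta_T}$, and let $P_n$ be the empirical measure of $X_1,\dots,X_n$. We write $Pf=\int f\,dP$. Put $$f(\theta,\alpha,x)=\phi'\Big(\tfrac{p_\theta(x)}{p_\alpha(x)}\Big),\quad g(\theta,\alpha,x)=\tfrac{p_\theta(x)}{p_\alpha(x)}\phi'\Big(\tfrac{p_\theta(x)}{p_\alpha(x)}\Big)-\phi\Big(\tfrac{p_\theta(x)}{p_\alpha(x)}\Big),\quad h(\theta,\alpha,x)=P_\theta f(\theta,\alpha)-g(\theta,\alpha,x),$$ $$\widehat\alpha_\phi(\theta)\in\arg\sup_{\alpha\in\Theta}P_nh(\theta,\alpha),\qquad \widehat\theta_\phi\in\arg\inf_{\theta\in\Theta}\ \sup_{\alpha\in\Theta}P_nh(\theta,\alpha),\qquad I_{\theta_T}=\int\frac{p'_{\theta_T}{p'_{\theta_T}}^{T}}{p_{\theta_T}}\,d\lambda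 ,$$ where any choice of the optimizers is allowed for which $\widehat\theta_\phi$ and $\widehat\alpha_\phi(\widehat\theta_\phi)$ are measurable functions on the underlying probability space. \emph{Assumptions.} (A.4) The estimates exist and are consistent: with (inner) probability tending to one $\widehat\theta_\phi$ attains the infimum; $\widehat\theta_\phi\to\theta_T$ in probability; and for every $\varepsilon>0$ there is $\delta>0$ such that, with (inner) probability tending to one, for all $\theta\in\Theta$ with $\|\theta-\theta_T\|<\delta$, $\widehat\alpha_\phi(\theta)$ attains the supremum and $\|\widehat\alpha_\phi(\theta)-\theta_T\|<\varepsilon$. (A.5) There is a neighborhood $N\subseteq\Theta$ of $\theta_T$ such that the first and second order partial derivatives with respect to $(\theta,\alpha)$ of $f(\theta,\alpha,x)p_\theta(x)$ exist and are dominated on $N\times N$ by $\lambda$-integrable functions of $x$, and the third order partial derivatives of $h(\theta,\alpha,x)$ with respect to $(\theta,\alpha)$ exist and are dominated on $N\times N$ by a $P_{\theta_T}$-integrable function of $x$. (Existence of derivatives of order $k$ is understood as $k$-fold differentiability, and the domination is for a.e. $x$.) (A.6) The integrals $P_{\theta_T}\|\tfrac{\partial}{\partial\alpha}h(\theta_T,\theta_T)\|^2$,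 $P_{\theta_T}\|\tfrac{\partial}{\partial\theta}h(\theta_T,\theta_T)\|^2$, $P_{\theta_T}\|\tfrac{\partial^2}{\partial\alpha^2}h(\theta_T,\theta_T)\|$, $P_{\theta_T}\|\tfrac{\partial^2}{\partial\theta^2}h(\theta_T,\theta_T)\|$, $P_{\theta_T}\|\tfrac{\partial^2}{\partial\theta\partial\alpha}h(\theta_T,\theta_T)\|$ are finite, and the Fisher information matrix $I_{\theta_T}$ is non-singular. \emph{Conclusion.} Both $\sqrt n(\widehat\theta_\phi-\theta_T)$ and $\sqrt n(\widehat\alpha_\phi(\widehat\theta_\phi)-\theta_T)$ converge in distribution, as $n\to\infty$, to the centered multivariate normal law on $\mathbb R^d$ with covariance matrix $I_{\theta_T}^{-1}$. (So both estimates are asymptotically efficient, whatever the choice of $\phi$.) -/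

import Mathlib

open MeasureTheory ProbabilityTheory Filter Topology
open scoped ENNReal NNReal

noncomputable section

namespace PhiDiv

/-- The domain of a function `φ : ℝ → [0, ∞]`, i.e. the set where it is finite. -/
def dom (φ : ℝ → ℝ≥0∞) : Set ℝ := {x | φ x ≠ ∞}

/-- The real-valued version of `φ`; it is only meaningful on `dom φ`. -/
def phiReal (φ : ℝ → ℝ≥0∞) (x : ℝ) : ℝ := (φ x).toReal

/-- The derivative `φ'`; it is only used on the interior of `dom φ`. -/
def dphi (φ : ℝ → ℝ≥0∞) : ℝ → ℝ := deriv (phiReal φ)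

/-- The functions `φ` that generate the divergences: closed convex functions `ℝ → [0, ∞]` with
`φ 1 = 0` whose domain is an interval with endpoints `a < 1 < b`, strictly convex and essentially
smooth, with continuous derivatives up to order 4 on the interior of the domain. -/
structure IsGenerator (φ : ℝ → ℝ≥0∞) : Prop where
  convex : ConvexOn ℝ≥0 Set.univ φ
  closed : LowerSemicontinuous φ
  map_one : φ 1 = 0
  one_mem : (1 : ℝ) ∈ interior (dom φ)
  strictConvex : StrictConvexOn ℝ (interior (dom φ)) (phiReal φ)
  smooth_left : ∀ a : ℝ, IsGLB (dom φ) a → Tendsto (dphi φ) (𝓝[>] a) atBot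
  smooth_right : ∀ b : ℝ, IsLUB (dom φ) b → Tendsto (dphi φ) (𝓝[<] b) atTop
  contDiff : ContDiffOn ℝ 4 (phiReal φ) (interior (dom φ))

/-- The law `P_θ = p_θ · ν`. -/
def law {d : ℕ} {𝒳 : Type*} [MeasurableSpace 𝒳] (ν : Measure 𝒳)
    (p : EuclideanSpace ℝ (Fin d) → 𝒳 → ℝ) (θ : EuclideanSpace ℝ (Fin d)) : Measure 𝒳 :=
  ν.withDensity (fun x => ENNReal.ofReal (p θ x))

/-- `f(θ, α, x) = φ'(p_θ(x) / p_α(x))`. -/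
def fFun {d : ℕ} {𝒳 : Type*} (φ : ℝ → ℝ≥0∞) (p : EuclideanSpace ℝ (Fin d) → 𝒳 → ℝ)
    (θ α : EuclideanSpace ℝ (Fin d)) (x : 𝒳) : ℝ :=
  dphi φ (p θ x / p α x)

/-- `g(θ, α, x) = (p_θ(x) / p_α(x)) φ'(p_θ(x) / p_α(x)) - φ(p_θ(x) / p_α(x))`. -/
def gFun {d : ℕ} {𝒳 : Type*} (φ : ℝ → ℝ≥0∞) (p : EuclideanSpace ℝ (Fin d) → 𝒳 → ℝ)
    (θ α : EuclideanSpace ℝ (Fin d)) (x : 𝒳) : ℝ :=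
  p θ x / p α x * dphi φ (p θ x / p α x) - phiReal φ (p θ x / p α x)

/-- `h(θ, α, x) = P_θ f(θ, α) - g(θ, α, x)`. -/
def hFun {d : ℕ} {𝒳 : Type*} [MeasurableSpace 𝒳] (φ : ℝ → ℝ≥0∞) (ν : Measure 𝒳)
    (p : EuclideanSpace ℝ (Fin d) → 𝒳 → ℝ) (θ α : EuclideanSpace ℝ (Fin d)) (x : 𝒳) : ℝ :=
  (∫ y, fFun φ p θ α y ∂(law ν p θ)) - gFun φ p θ α x

/-- The standing assumptions on the model `{P_θ ; θ ∈ Θ}` and the generator `φ`. -/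
structure IsModel {d : ℕ} {𝒳 : Type*} [MeasurableSpace 𝒳] (φ : ℝ → ℝ≥0∞) (ν : Measure 𝒳)
    (Θ : Set (EuclideanSpace ℝ (Fin d))) (p : EuclideanSpace ℝ (Fin d) → 𝒳 → ℝ) : Prop where
  measurable : ∀ θ ∈ Θ, Measurable (p θ)
  nonneg : ∀ θ ∈ Θ, ∀ x, 0 ≤ p θ x
  isProbabilityMeasure : ∀ θ ∈ Θ, IsProbabilityMeasure (law ν p θ)
  identifiable : Set.InjOn (law ν p) Θ
  /-- the support does not depend on the parameter -/
  support : ∀ᵐ x ∂ν, (∀ θ ∈ Θ, 0 < p θ x) ∨ (∀ θ ∈ Θ, p θ x = 0)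
  /-- on the support, `φ'(p_θ / p_α)` is well defined -/
  ratio_mem : ∀ᵐ x ∂ν, ∀ θ ∈ Θ, ∀ α ∈ Θ, 0 < p α x → p θ x / p α x ∈ interior (dom φ)
  integrable : ∀ θ ∈ Θ, ∀ α ∈ Θ, Integrable (fFun φ p θ α) (law ν p θ)
  contDiff : ∀ᵐ x ∂ν, ContDiffOn ℝ 3 (fun θ => p θ x) (interior Θ)

/-- The Fisher information matrix `I_θ = ∫ p_θ' (p_θ')ᵀ / p_θ dν`. -/
def fisher {d : ℕ} {𝒳 : Type*} [MeasurableSpace 𝒳] (ν : Measure 𝒳)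
    (p : EuclideanSpace ℝ (Fin d) → 𝒳 → ℝ) (θ : EuclideanSpace ℝ (Fin d)) :
    Matrix (Fin d) (Fin d) ℝ :=
  Matrix.of fun i j => ∫ x,
    fderiv ℝ (fun θ' => p θ' x) θ (EuclideanSpace.single i 1) *
      fderiv ℝ (fun θ' => p θ' x) θ (EuclideanSpace.single j 1) / p θ x ∂ν

/-- `P_n h(θ, α)`, where `P_n` is the empirical measure of the points `x 0, …, x (n - 1)`. -/
def empH {d : ℕ} {𝒳 : Type*} [MeasurableSpace 𝒳] (φ : ℝ → ℝ≥0∞) (ν : Measure 𝒳)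
    (p : EuclideanSpace ℝ (Fin d) → 𝒳 → ℝ) (n : ℕ) (x : ℕ → 𝒳)
    (θ α : EuclideanSpace ℝ (Fin d)) : ℝ :=
  (n : ℝ)⁻¹ * ∑ i ∈ Finset.range n, hFun φ ν p θ α (x i)

/-- `α₀` is a value of the dual `φ`-divergence estimate `α̂_φ(θ)`: it maximizes
`α ↦ P_n h(θ, α)` over `Θ`. -/
def IsDualEstimate {d : ℕ} {𝒳 : Type*} [MeasurableSpace 𝒳] (φ : ℝ → ℝ≥0∞) (ν : Measure 𝒳)
    (Θ : Set (EuclideanSpace ℝ (Fin d))) (p : EuclideanSpace ℝ (Fin d) → 𝒳 → ℝ)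
    (n : ℕ) (x : ℕ → 𝒳) (θ α₀ : EuclideanSpace ℝ (Fin d)) : Prop :=
  α₀ ∈ Θ ∧ ∀ α ∈ Θ, empH φ ν p n x θ α ≤ empH φ ν p n x θ α₀

/-- `θ₀` is a value of the minimum dual `φ`-divergence estimate `θ̂_φ`: it minimizes
`θ ↦ sup_{α ∈ Θ} P_n h(θ, α)` over `Θ`, the supremum being taken in `[-∞, ∞]`. -/
def IsMinMaxEstimate {d : ℕ} {𝒳 : Type*} [MeasurableSpace 𝒳] (φ : ℝ → ℝ≥0∞) (ν : Measure 𝒳)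
    (Θ : Set (EuclideanSpace ℝ (Fin d))) (p : EuclideanSpace ℝ (Fin d) → 𝒳 → ℝ)
    (n : ℕ) (x : ℕ → 𝒳) (θ₀ : EuclideanSpace ℝ (Fin d)) : Prop :=
  θ₀ ∈ Θ ∧ ∀ θ ∈ Θ,
    (⨆ α ∈ Θ, (empH φ ν p n x θ₀ α : EReal)) ≤ ⨆ α ∈ Θ, (empH φ ν p n x θ α : EReal)

/-- The estimates `θ̂ₙ` and `α̂ₙ(θ)` exist (with probability tending to one, `θ` near `θT`) and are
consistent, the consistency of `α̂ₙ(θ)` being locally uniform in `θ` at `θT`. Probabilities of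
possibly non-measurable events are outer probabilities. -/
structure ConsistentEstimates {d : ℕ} {𝒳 Ω : Type*} [MeasurableSpace 𝒳] [MeasurableSpace Ω]
    (φ : ℝ → ℝ≥0∞) (ν : Measure 𝒳)
    (Θ : Set (EuclideanSpace ℝ (Fin d))) (p : EuclideanSpace ℝ (Fin d) → 𝒳 → ℝ)
    (μ : Measure Ω) (X : ℕ → Ω → 𝒳) (θT : EuclideanSpace ℝ (Fin d))
    (θhat : ℕ → Ω → EuclideanSpace ℝ (Fin d))
    (αhat : ℕ → Ω → EuclideanSpace ℝ (Fin d) → EuclideanSpace ℝ (Fin d)) : Prop where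
  exists_theta : Tendsto
    (fun n => μ {ω | ¬ IsMinMaxEstimate φ ν Θ p n (fun i => X i ω) (θhat n ω)}) atTop (𝓝 0)
  consistent_theta : TendstoInMeasure μ θhat atTop (fun _ => θT)
  consistent_alpha : ∀ ε > 0, ∃ δ > 0, Tendsto
    (fun n => μ {ω | ¬ ∀ θ ∈ Θ, dist θ θT < δ →
      IsDualEstimate φ ν Θ p n (fun i => X i ω) θ (αhat n ω θ) ∧ dist (αhat n ω θ) θT < ε})
    atTop (𝓝 0)

/-- For `m`-almost every `x`, the function `(θ, α) ↦ F θ α x` is `k` times differentiable at every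
point of `N × N`, and its derivatives of order `k` are dominated there by an `m`-integrable
function of `x`. -/
def DominatedDeriv {d : ℕ} {𝒳 : Type*} [MeasurableSpace 𝒳] (k : ℕ)
    (F : EuclideanSpace ℝ (Fin d) → EuclideanSpace ℝ (Fin d) → 𝒳 → ℝ)
    (N : Set (EuclideanSpace ℝ (Fin d))) (m : Measure 𝒳) : Prop :=
  ∃ G : 𝒳 → ℝ, Integrable G m ∧ ∀ᵐ x ∂m, ∀ z ∈ N ×ˢ N,
    (∀ j < k, DifferentiableAt ℝ (iteratedFDeriv ℝ j
      (fun w : EuclideanSpace ℝ (Fin d) × EuclideanSpace ℝ (Fin d) => F w.1 w.2 x)) z) ∧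
    ‖iteratedFDeriv ℝ k
      (fun w : EuclideanSpace ℝ (Fin d) × EuclideanSpace ℝ (Fin d) => F w.1 w.2 x) z‖ ≤ G x

/-- Domination, on `N × N` for a neighbourhood `N` of `θT`, of the first and second derivatives of
`f(θ, α, x) p_θ(x)` and of the third derivatives of `h(θ, α, x)`. -/
def DominationCondition {d : ℕ} {𝒳 : Type*} [MeasurableSpace 𝒳] (φ : ℝ → ℝ≥0∞) (ν : Measure 𝒳)
    (Θ : Set (EuclideanSpace ℝ (Fin d))) (p : EuclideanSpace ℝ (Fin d) → 𝒳 → ℝ)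
    (θT : EuclideanSpace ℝ (Fin d)) : Prop :=
  ∃ N : Set (EuclideanSpace ℝ (Fin d)), IsOpen N ∧ θT ∈ N ∧ N ⊆ Θ ∧
    DominatedDeriv 1 (fun θ α x => fFun φ p θ α x * p θ x) N ν ∧
    DominatedDeriv 2 (fun θ α x => fFun φ p θ α x * p θ x) N ν ∧
    DominatedDeriv 3 (hFun φ ν p) N (law ν p θT)

/-- Finiteness of the moments of the derivatives of `h` at `(θT, θT)`, and non-singularity of the
Fisher information matrix. -/
structure MomentCondition {d : ℕ} {𝒳 : Type*} [MeasurableSpace 𝒳] (φ : ℝ → ℝ≥0∞) (ν : Measure 𝒳)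
    (p : EuclideanSpace ℝ (Fin d) → 𝒳 → ℝ) (θT : EuclideanSpace ℝ (Fin d)) : Prop where
  d_alpha : Integrable (fun x => ‖fderiv ℝ (fun α => hFun φ ν p θT α x) θT‖ ^ 2) (law ν p θT)
  d_theta : Integrable (fun x => ‖fderiv ℝ (fun θ => hFun φ ν p θ θT x) θT‖ ^ 2) (law ν p θT)
  d_alpha_alpha : Integrable (fun x =>
    ‖fderiv ℝ (fun α => fderiv ℝ (fun α' => hFun φ ν p θT α' x) α) θT‖) (law ν p θT)
  d_theta_theta : Integrable (fun x =>
    ‖fderiv ℝ (fun θ => fderiv ℝ (fun θ' => hFun φ ν p θ' θT x) θ) θT‖) (law ν p θT)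
  d_theta_alpha : Integrable (fun x =>
    ‖fderiv ℝ (fun θ => fderiv ℝ (fun α => hFun φ ν p θ α x) θT) θT‖) (law ν p θT)
  fisher_det : (fisher ν p θT).det ≠ 0

end PhiDiv

end

/-! Write c = φ''(1), I for the Fisher information at θT, s for the score p'/p at θT and M_n(θ, α) =
P_n h(θ, α). Since φ'(1) = 0, the derivative of f p_θ on the diagonal in direction (v, w) is c (D_v
p − D_w p). Differentiation under the integral sign then shows that h has derivative −c⟨v − w, s⟩ at
(θT, θT), and that its second derivative there has expected quadratic form c (vᵀIv − wᵀIw), a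
nondegenerate saddle without cross term (`derivs_hPair`). The law of large numbers and the dominated
third derivatives make this uniform: on a small fixed ball, with probability tending to one, the
derivative of M_n differs from the linear map S of that saddle by a map with small Lipschitz
constant (`exists_eventuallyLikely_empirical`).

Replacing the derivative of M_n by its value at the center plus S, the only zero is the displacement
(y, y) with y = I⁻¹ P_n s. A true critical point in the ball therefore has both displacements equal
to y up to a small multiple of ‖y‖ (`norm_sub_le_of_norm_blockForm_le`). By the central limit
theorem √n y tends to the centered normal law with covariance I⁻¹ I I⁻¹ = I⁻¹
(`tendstoInDistribution_score`). The error is relative to ‖y‖ and √n y is bounded in probability, so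
Slutsky's theorem concludes without a separate proof of the √n rate.

The delicate point is that (θ̂, α̂(θ̂)) is a critical point of M_n, because θ ↦ α̂(θ) is an
arbitrary choice of maximizers with no assumed regularity (`fderiv_eq_zero_of_minimax`). Maximality
kills the α-derivative. Nondegeneracy of the α-block then forces ‖α̂(θ) − α̂(θ̂)‖ ≤ ‖θ − θ̂‖, and an
envelope argument kills the θ-derivative. -/

/-! ### Multivariate central limit theorem -/

/-- The **multivariate central limit theorem** for centered square integrable vectors. -/
theorem tendstoInDistribution_inv_sqrt_smul_sum_multivariateGaussian {d : ℕ} {Ω : Type*}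
    [MeasurableSpace Ω] {μ : Measure Ω} [IsProbabilityMeasure μ]
    {Y : ℕ → Ω → EuclideanSpace ℝ (Fin d)} {S : Matrix (Fin d) (Fin d) ℝ} (hS : S.PosSemidef)
    (hindep : iIndepFun Y μ) (hident : ∀ i, IdentDistrib (Y i) (Y 0) μ μ)
    (hL2 : ∀ t, MemLp (fun ω => inner ℝ t (Y 0 ω)) 2 μ)
    (hmean : ∀ t, ∫ ω, inner ℝ t (Y 0 ω) ∂μ = 0)
    (hcov : ∀ t, ∫ ω, (inner ℝ t (Y 0 ω)) ^ 2 ∂μ = t.ofLp ⬝ᵥ S.mulVec t.ofLp) :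
    TendstoInDistribution (fun (n : ℕ) ω => (√n)⁻¹ • ∑ k ∈ Finset.range n, Y k ω) atTop id
      (fun _ => μ) (multivariateGaussian 0 S) := by
  have mY i : AEMeasurable (Y i) μ := (hident i).aemeasurable_fst
  have mW : ∀ n : ℕ, AEMeasurable (fun ω => (√n)⁻¹ • ∑ k ∈ Finset.range n, Y k ω) μ := fun n =>
    (Finset.aemeasurable_fun_sum (Finset.range n) fun i _ => mY i).const_smul ((√n)⁻¹ : ℝ)
  refine ⟨mW, by fun_prop, ProbabilityMeasure.tendsto_iff_tendsto_charFun.2 fun t => ?_⟩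
  have mt : Measurable fun x : EuclideanSpace ℝ (Fin d) => inner ℝ t x := by fun_prop
  have hvar : Var[fun ω => inner ℝ t (Y 0 ω); μ] = t.ofLp ⬝ᵥ S.mulVec t.ofLp := by
    rw [variance_eq_integral (X := fun ω => inner ℝ t (Y 0 ω)) (mt.comp_aemeasurable (mY 0)),
      hmean t, ← hcov t]
    simp
  have key := tendstoInDistribution_inv_sqrt_mul_sum_sub
    (P' := gaussianReal 0 Var[fun ω => inner ℝ t (Y 0 ω); μ].toNNReal) (Y := id)
    (X := fun k ω => inner ℝ t (Y k ω)) (P := μ) ⟨by fun_prop, by simp⟩ (hL2 t)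
    (hindep.comp (fun _ x => inner ℝ t x) fun _ => mt) (fun i => (hident i).comp mt)
  -- Cramér–Wold: the characteristic function of a vector at t is that of its inner product with t
  -- at 1.
  have key1 := ProbabilityMeasure.tendsto_iff_tendsto_charFun.1 key.tendsto 1
  have hnn : 0 ≤ t.ofLp ⬝ᵥ S.mulVec t.ofLp := by
    rw [← hcov t]; exact integral_nonneg fun _ => sq_nonneg _
  convert! key1 using 2
  · rename_i n
    simp only [ProbabilityMeasure.coe_mk, charFun_apply]
    rw [integral_map (mW n) (by fun_prop), integral_map (key.forall_aemeasurable n) (by fun_prop)]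
    congr 1
    ext ω
    simp [hmean t, real_inner_comm t, inner_smul_right, inner_sum]
  · simp only [ProbabilityMeasure.coe_mk, Measure.map_id, charFun_multivariateGaussian hS,
      charFun_gaussianReal, hvar]
    simp [hnn]

/-! ### Events of probability tending to one, and Slutsky's theorem -/

/-- The events `E n` have (inner) probability tending to one. -/
def EventuallyLikely {Ω : Type*} [MeasurableSpace Ω] (μ : Measure Ω) (E : ℕ → Ω → Prop) : Prop :=
  Tendsto (fun n => μ {ω | ¬ E n ω}) atTop (𝓝 0)

namespace EventuallyLikely

variable {Ω : Type*} [MeasurableSpace Ω] {μ : Measure Ω} {E F : ℕ → Ω → Prop}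

lemma mono (hE : EventuallyLikely μ E) (h : ∀ᶠ n in atTop, ∀ ω, E n ω → F n ω) :
    EventuallyLikely μ F :=
  tendsto_of_tendsto_of_tendsto_of_le_of_le' tendsto_const_nhds hE
    (Eventually.of_forall fun _ => zero_le) (h.mono fun _ hn => measure_mono fun ω hω h' => hω (hn ω h'))

lemma and (hE : EventuallyLikely μ E) (hF : EventuallyLikely μ F) :
    EventuallyLikely μ fun n ω => E n ω ∧ F n ω := by
  refine tendsto_of_tendsto_of_tendsto_of_le_of_le tendsto_const_nhds
    (by simpa using Tendsto.add hE hF) (fun _ => zero_le) fun n => ?_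
  refine (measure_mono ?_).trans (measure_union_le _ _)
  intro ω hω
  by_cases h : E n ω
  · exact Or.inr fun h' => hω ⟨h, h'⟩
  · exact Or.inl h

lemma of_ae {A : Ω → Prop} (h : ∀ᵐ ω ∂μ, A ω) : EventuallyLikely μ fun _ => A := by
  have : μ {ω | ¬ A ω} = 0 := h
  simp [EventuallyLikely, this]

lemma forall_finite {ι : Type*} [Finite ι] {E : ι → ℕ → Ω → Prop}
    (h : ∀ i, EventuallyLikely μ (E i)) : EventuallyLikely μ fun n ω => ∀ i, E i n ω := by
  have := Fintype.ofFinite ι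
  refine tendsto_of_tendsto_of_tendsto_of_le_of_le tendsto_const_nhds
    (by simpa using tendsto_finsetSum Finset.univ fun i _ => h i) (fun _ => zero_le) fun n => ?_
  refine (measure_mono ?_).trans (measure_biUnion_finset_le _ _)
  intro ω hω
  simpa using hω

lemma of_tendstoInMeasure {V : Type*} [SeminormedAddCommGroup V] {Y : ℕ → Ω → V} {y : Ω → V}
    (h : TendstoInMeasure μ Y atTop y) {ε : ℝ} (hε : 0 < ε) :
    EventuallyLikely μ fun n ω => ‖Y n ω - y ω‖ < ε := by
  simpa [EventuallyLikely] using tendstoInMeasure_iff_norm.1 h ε hε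

/-- The weak law of large numbers for functions of an i.i.d. sequence. -/
lemma abs_mean_sub_lt {𝒳 : Type*} [MeasurableSpace 𝒳] {P : Measure 𝒳} [IsProbabilityMeasure μ]
    {X : ℕ → Ω → 𝒳} (hX : ∀ i, Measurable (X i)) (hindep : iIndepFun X μ)
    (hlaw : ∀ i, μ.map (X i) = P) {f : 𝒳 → ℝ} (hf : Integrable f P) {ε : ℝ} (hε : 0 < ε) :
    EventuallyLikely μ fun n ω =>
      |(n : ℝ)⁻¹ * ∑ i ∈ Finset.range n, f (X i ω) - ∫ x, f x ∂P| < ε := by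
  have hfi : ∀ i, AEMeasurable f (μ.map (X i)) := fun i => by
    rw [hlaw i]; exact hf.aestronglyMeasurable.aemeasurable
  have hint : Integrable (fun ω => f (X 0 ω)) μ := by
    rw [← hlaw 0] at hf
    exact hf.comp_measurable (hX 0)
  have key := strong_law_ae_real (μ := μ) (fun i ω => f (X i ω)) hint
    (fun i j hij => (hindep.comp₀ (fun _ => f) (fun i => (hX i).aemeasurable) hfi).indepFun hij)
    (fun i => IdentDistrib.comp_of_aemeasurable
      ⟨(hX i).aemeasurable, (hX 0).aemeasurable, by rw [hlaw, hlaw]⟩ (hfi i))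
  have hmean : ∫ ω, f (X 0 ω) ∂μ = ∫ x, f x ∂P := by
    rw [← hlaw 0, integral_map (hX 0).aemeasurable]
    rw [hlaw 0]; exact hf.aestronglyMeasurable
  refine (of_tendstoInMeasure (tendstoInMeasure_of_tendsto_ae (fun n => ?_) key) hε).mono
    (Eventually.of_forall fun n ω h => ?_)
  · refine AEMeasurable.aestronglyMeasurable (AEMeasurable.div_const ?_ _)
    exact Finset.aemeasurable_fun_sum _ fun i _ => (hfi i).comp_aemeasurable (hX i).aemeasurable
  · rw [hmean, Real.norm_eq_abs] at h
    rwa [inv_mul_eq_div]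

/-- A sequence that converges in distribution is bounded in probability. -/
lemma exists_norm_lt {V : Type*} [NormedAddCommGroup V] [MeasurableSpace V] [BorelSpace V]
    [IsProbabilityMeasure μ] {γ : Measure V} [IsProbabilityMeasure γ] {Z : ℕ → Ω → V}
    (hZ : TendstoInDistribution Z atTop id (fun _ => μ) γ) {ε : ℝ≥0∞} (hε : ε ≠ 0) :
    ∃ K : ℝ, ∀ᶠ n in atTop, μ {ω | K ≤ ‖Z n ω‖} < ε := by
  have h1 : Tendsto (fun m : ℕ => γ {x | (m : ℝ) ≤ ‖x‖}) atTop (𝓝 0) := by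
    have := tendsto_measure_iInter_atTop (μ := γ) (s := fun m : ℕ => {x | (m : ℝ) ≤ ‖x‖})
      (fun m => (measurableSet_le measurable_const measurable_norm).nullMeasurableSet)
      (fun m m' hm x (hx : (m' : ℝ) ≤ ‖x‖) => show (m : ℝ) ≤ ‖x‖ from (Nat.cast_le.2 hm).trans hx) ⟨0, measure_ne_top _ _⟩
    have he : (⋂ m : ℕ, {x : V | (m : ℝ) ≤ ‖x‖}) = ∅ := by
      ext x
      simpa using exists_nat_gt ‖x‖
    simpa [he, Function.comp_def] using this
  obtain ⟨m, hm⟩ := (h1.eventually (gt_mem_nhds (pos_iff_ne_zero.2 hε))).exists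
  refine ⟨m, ?_⟩
  have hclosed : IsClosed {x : V | (m : ℝ) ≤ ‖x‖} := isClosed_le continuous_const continuous_norm
  have h2 := ProbabilityMeasure.limsup_measure_closed_le_of_tendsto hZ.tendsto hclosed
  simp only [ProbabilityMeasure.coe_mk, Measure.map_id] at h2
  refine (eventually_lt_of_limsup_lt (h2.trans_lt hm)).mono fun n hn => ?_
  rwa [Measure.map_apply_of_aemeasurable (hZ.forall_aemeasurable n) hclosed.measurableSet] at hn

/-- Slutsky's theorem for a relative error that tends to zero in probability. -/
theorem tendstoInDistribution_of_relative_error {V : Type*} [NormedAddCommGroup V]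
    [SecondCountableTopology V] [MeasurableSpace V] [BorelSpace V]
    [IsProbabilityMeasure μ] {γ : Measure V} [IsProbabilityMeasure γ] {Z Y : ℕ → Ω → V}
    (hZ : TendstoInDistribution Z atTop id (fun _ => μ) γ) (hY : ∀ n, AEMeasurable (Y n) μ)
    (h : ∀ η > 0, EventuallyLikely μ fun n ω => ‖Y n ω - Z n ω‖ ≤ η * ‖Z n ω‖) :
    TendstoInDistribution Y atTop id (fun _ => μ) γ := by
  refine tendstoInDistribution_of_tendstoInMeasure_sub Y id hZ ?_ hY
  refine tendstoInMeasure_iff_norm.2 fun ε hε => ENNReal.tendsto_nhds_zero.2 fun κ hκ => ?_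
  obtain ⟨K, hK⟩ := exists_norm_lt hZ (ENNReal.half_pos hκ.ne').ne'
  -- The bound K need not be positive, and it is divided by below.
  have hK' : 0 < max K 1 := by positivity
  have h2 := ENNReal.tendsto_nhds_zero.1 (h (ε / (2 * max K 1)) (by positivity)) (κ / 2)
    (ENNReal.half_pos hκ.ne')
  filter_upwards [hK, h2] with n h1 h2
  calc _ ≤ μ ({ω | K ≤ ‖Z n ω‖} ∪ {ω | ¬ ‖Y n ω - Z n ω‖ ≤ ε / (2 * max K 1) * ‖Z n ω‖}) := by
        refine measure_mono fun ω hω => ?_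
        by_contra hcon
        simp only [Set.mem_union, Set.mem_ofPred_eq, not_or, not_le] at hcon
        have hω : ε ≤ ‖Y n ω - Z n ω‖ := by simpa using hω
        have : ε / (2 * max K 1) * ‖Z n ω‖ ≤ ε / (2 * max K 1) * max K 1 := by
          gcongr
          exact hcon.1.le.trans (le_max_left _ _)
        have e : ε / (2 * max K 1) * max K 1 = ε / 2 := by field_simp
        linarith [hcon.2]
    _ ≤ _ := (measure_union_le _ _).trans (by
        refine (add_le_add h1.le h2).trans ?_
        rw [ENNReal.add_halves])

end EventuallyLikely

/-! ### Minimax points are critical points -/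

lemma norm_sub_sub_apply_le_of_norm_hasFDerivAt_sub_le {V W : Type*} [NormedAddCommGroup V]
    [NormedSpace ℝ V] [NormedAddCommGroup W] [NormedSpace ℝ W] {Ψ : V → W} {Ψ' : V → V →L[ℝ] W}
    {S : V →L[ℝ] W} {s : Set V} (hs : Convex ℝ s) {η : ℝ}
    (hΨ : ∀ z ∈ s, HasFDerivAt Ψ (Ψ' z) z) (hη : ∀ z ∈ s, ‖Ψ' z - S‖ ≤ η) {z z' : V}
    (hz : z ∈ s) (hz' : z' ∈ s) : ‖Ψ z - Ψ z' - S (z - z')‖ ≤ η * ‖z - z'‖ :=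
  hs.norm_image_sub_le_of_norm_hasFDerivWithin_le' (fun x hx => (hΨ x hx).hasFDerivWithinAt) hη
    hz' hz

/-- If `a θ` maximizes `M (θ, ·)` locally, `θ₁` minimizes `θ ↦ M (θ, a θ)` locally, and the
derivative of `M` is close to a linear map that is bounded below on the second factor, then
`(θ₁, a θ₁)` is a critical point of `M`. -/
theorem fderiv_eq_zero_of_minimax {E F : Type*} [NormedAddCommGroup E] [NormedSpace ℝ E]
    [NormedAddCommGroup F] [NormedSpace ℝ F] {M : E × F → ℝ} {Ψ : E × F → E × F →L[ℝ] ℝ}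
    {θ₀ : E} {α₀ : F} {ε δ η κ : ℝ} {S : E × F →L[ℝ] E × F →L[ℝ] ℝ} (hδ : δ ≤ ε) (hη : η < κ)
    (hM : ∀ z ∈ Metric.ball (θ₀, α₀) ε, HasFDerivAt M (Ψ z) z)
    (hlin : ∀ z ∈ Metric.ball (θ₀, α₀) ε, ∀ z' ∈ Metric.ball (θ₀, α₀) ε,
      ‖Ψ z - Ψ z' - S (z - z')‖ ≤ η * ‖z - z'‖)
    (hS : ∀ v w, κ * ‖w‖ ≤ ‖(S (v, w)).comp (ContinuousLinearMap.inr ℝ E F)‖)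
    {a : E → F} (ha : ∀ θ ∈ Metric.ball θ₀ δ, a θ ∈ Metric.ball α₀ ε)
    (hmax : ∀ θ ∈ Metric.ball θ₀ δ, ∀ α ∈ Metric.ball α₀ ε, M (θ, α) ≤ M (θ, a θ))
    {θ₁ : E} (hθ₁ : θ₁ ∈ Metric.ball θ₀ δ)
    (hmin : ∀ θ ∈ Metric.ball θ₀ δ, M (θ₁, a θ₁) ≤ M (θ, a θ)) : Ψ (θ₁, a θ₁) = 0 := by
  have hmem : ∀ θ ∈ Metric.ball θ₀ δ, ∀ α ∈ Metric.ball α₀ ε,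
      (θ, α) ∈ Metric.ball (θ₀, α₀) ε := fun θ hθ α hα => by
    rw [← ball_prod_same]
    exact ⟨Metric.ball_subset_ball hδ hθ, hα⟩
  have hsnd : ∀ θ ∈ Metric.ball θ₀ δ,
      (Ψ (θ, a θ)).comp (ContinuousLinearMap.inr ℝ E F) = 0 := fun θ hθ => by
    have h1 : HasFDerivAt (fun α => M (θ, α))
        ((Ψ (θ, a θ)).comp (ContinuousLinearMap.inr ℝ E F)) (a θ) :=
      (hM _ (hmem θ hθ _ (ha θ hθ))).comp (a θ) (hasFDerivAt_prodMk_right θ (a θ))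
    exact IsLocalMax.hasFDerivAt_eq_zero
      (Filter.eventually_of_mem (Metric.isOpen_ball.mem_nhds (ha θ hθ)) (hmax θ hθ)) h1
  -- Both α-derivatives vanish, so the α-part of S at the increment is at most η times its sup norm,
  -- while it is at least κ‖Δα‖ whatever Δθ is. If ‖Δα‖ > ‖Δθ‖, the sup norm is ‖Δα‖ and η < κ is
  -- contradicted.
  have hcont : ∀ θ ∈ Metric.ball θ₀ δ, ‖a θ - a θ₁‖ ≤ ‖θ - θ₁‖ := fun θ hθ => by
    by_contra! hlt
    have h1 := hlin _ (hmem θ hθ _ (ha θ hθ)) _ (hmem θ₁ hθ₁ _ (ha θ₁ hθ₁))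
    have h2 := hS (θ - θ₁) (a θ - a θ₁)
    have h3 : (S (θ - θ₁, a θ - a θ₁)).comp (ContinuousLinearMap.inr ℝ E F) =
        -(Ψ (θ, a θ) - Ψ (θ₁, a θ₁) - S ((θ, a θ) - (θ₁, a θ₁))).comp
          (ContinuousLinearMap.inr ℝ E F) := by
      rw [ContinuousLinearMap.sub_comp, ContinuousLinearMap.sub_comp, hsnd θ hθ, hsnd θ₁ hθ₁]
      simp
    rw [h3, norm_neg] at h2
    have h4 := h2.trans ((ContinuousLinearMap.opNorm_comp_le _ _).trans
      (mul_le_mul h1 (ContinuousLinearMap.norm_inr_le_one ℝ E F) (norm_nonneg _)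
        ((norm_nonneg _).trans h1)))
    have h5 : ‖(θ, a θ) - (θ₁, a θ₁)‖ = ‖a θ - a θ₁‖ := by
      rw [Prod.mk_sub_mk, Prod.norm_mk, max_eq_right hlt.le]
    rw [h5, mul_one] at h4
    have h6 : 0 < ‖a θ - a θ₁‖ := (norm_nonneg _).trans_lt hlt
    exact absurd (le_of_mul_le_mul_right h4 h6) (not_le.2 hη)
  have hu := hmem θ₁ hθ₁ _ (ha θ₁ hθ₁)
  -- Ψ differs from an affine continuous map by at most η‖z − (θ₁, a θ₁)‖.
  have hΨcont : ContinuousAt Ψ (θ₁, a θ₁) := by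
    have h0 : Tendsto (fun z => Ψ (θ₁, a θ₁) + S (z - (θ₁, a θ₁)) +
        (Ψ z - Ψ (θ₁, a θ₁) - S (z - (θ₁, a θ₁)))) (𝓝 (θ₁, a θ₁))
        (𝓝 (Ψ (θ₁, a θ₁) + S ((θ₁, a θ₁) - (θ₁, a θ₁)) + 0)) := by
      refine Tendsto.add (Continuous.tendsto (by fun_prop) _) ?_
      refine squeeze_zero_norm' (a := fun z => η * ‖z - (θ₁, a θ₁)‖) ?_ ?_
      · exact Filter.eventually_of_mem (Metric.isOpen_ball.mem_nhds hu) fun z hz => hlin z hz _ hu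
      · exact Continuous.tendsto' (by fun_prop) _ _ (by simp)
    simpa [ContinuousAt] using h0
  have hstrict : HasStrictFDerivAt M (Ψ (θ₁, a θ₁)) (θ₁, a θ₁) :=
    hasStrictFDerivAt_of_hasFDerivAt_of_continuousAt
      (Filter.eventually_of_mem (Metric.isOpen_ball.mem_nhds hu) hM) hΨcont
  have hfst_nonneg : ∀ v, 0 ≤ Ψ (θ₁, a θ₁) (v, 0) := fun v => by
    have hθt : Tendsto (fun t : ℝ => θ₁ + t • v) (𝓝[>] 0) (𝓝 θ₁) :=
      (Continuous.tendsto' (by fun_prop) _ _ (by simp)).mono_left nhdsWithin_le_nhds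
    have hθmem : ∀ᶠ t : ℝ in 𝓝[>] 0, θ₁ + t • v ∈ Metric.ball θ₀ δ :=
      hθt.eventually (Metric.isOpen_ball.mem_nhds hθ₁)
    have hαt : Tendsto (fun t : ℝ => a (θ₁ + t • v)) (𝓝[>] 0) (𝓝 (a θ₁)) := by
      rw [tendsto_iff_norm_sub_tendsto_zero]
      refine squeeze_zero' (Eventually.of_forall fun _ => norm_nonneg _)
        (hθmem.mono fun t ht => hcont _ ht) ?_
      exact tendsto_iff_norm_sub_tendsto_zero.1 hθt
    -- Strict differentiability compares (θ, a θ) with (θ₁, a θ) for θ = θ₁ + t v. Both points move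
    -- with t, but their difference is t (v, 0), so no α-increment appears.
    have ho := hstrict.isLittleO.comp_tendsto
      ((hθt.prodMk_nhds hαt).prodMk_nhds ((tendsto_const_nhds (x := θ₁)).prodMk_nhds hαt))
    by_contra! hneg
    have hb := ho.bound (c := -Ψ (θ₁, a θ₁) (v, 0) / (2 * (‖v‖ + 1))) (by
      apply div_pos <;> [linarith; positivity])
    obtain ⟨t, ht, ht0, hθ⟩ := (hb.and (eventually_mem_nhdsWithin.and hθmem)).exists
    have ht0 : 0 < t := ht0
    -- M(θ₁, a θ) ≤ M(θ₁, a θ₁) ≤ M(θ, a θ): the increment being estimated is nonnegative.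
    have h1 := (hmin _ hθ).trans' (hmax _ hθ₁ _ (ha _ hθ))
    have e : ((θ₁ + t • v, a (θ₁ + t • v)) - (θ₁, a (θ₁ + t • v)) : E × F) = t • (v, 0) := by
      simp
    simp only [Function.comp, e, map_smul, smul_eq_mul, norm_smul, Prod.norm_mk, norm_zero,
      Real.norm_eq_abs, abs_of_pos ht0, max_eq_left (norm_nonneg v)] at ht
    have h2 := (le_abs_self _).trans ht
    have h3 : -Ψ (θ₁, a θ₁) (v, 0) / (2 * (‖v‖ + 1)) * (t * ‖v‖) ≤
        t * (-Ψ (θ₁, a θ₁) (v, 0) / 2) := by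
      have : ‖v‖ / (‖v‖ + 1) ≤ 1 := by rw [div_le_one (by positivity)]; linarith
      calc _ = t * (-Ψ (θ₁, a θ₁) (v, 0) / 2) * (‖v‖ / (‖v‖ + 1)) := by field_simp
        _ ≤ _ := mul_le_of_le_one_right (mul_nonneg ht0.le (by linarith)) this
    nlinarith
  ext v
  · have h1 := hfst_nonneg v
    have h2 := hfst_nonneg (-v)
    have h3 : Ψ (θ₁, a θ₁) (-v, 0) = -Ψ (θ₁, a θ₁) (v, 0) := by
      rw [← map_neg]; simp
    have : Ψ (θ₁, a θ₁) (v, 0) = 0 := by linarith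
    simpa using this
  · have := congrArg (fun L => L v) (hsnd θ₁ hθ₁)
    simpa using this

/-! ### From iterated derivatives to nested Fréchet derivatives -/

section IteratedDerivatives

variable {V W : Type*} [NormedAddCommGroup V] [NormedSpace ℝ V] [NormedAddCommGroup W]
  [NormedSpace ℝ W] {f : V → W} {z : V}

lemma differentiableAt_iteratedFDeriv_zero :
    DifferentiableAt ℝ (iteratedFDeriv ℝ 0 f) z ↔ DifferentiableAt ℝ f z := by
  rw [iteratedFDeriv_zero_eq_comp, LinearIsometryEquiv.comp_differentiableAt_iff]

set_option maxSynthPendingDepth 5 in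
lemma differentiableAt_iteratedFDeriv_succ {n : ℕ} :
    DifferentiableAt ℝ (iteratedFDeriv ℝ (n + 1) f) z ↔
      DifferentiableAt ℝ (iteratedFDeriv ℝ n (fderiv ℝ f)) z := by
  have : iteratedFDeriv ℝ (n + 1) f =
      (continuousMultilinearCurryRightEquiv' ℝ n V W).symm ∘ iteratedFDeriv ℝ n (fderiv ℝ f) := by
    ext1 x; exact iteratedFDeriv_succ_eq_comp_right
  rw [this, LinearIsometryEquiv.comp_differentiableAt_iff]

lemma differentiableAt_iteratedFDeriv_one :
    DifferentiableAt ℝ (iteratedFDeriv ℝ 1 f) z ↔ DifferentiableAt ℝ (fderiv ℝ f) z := by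
  rw [differentiableAt_iteratedFDeriv_succ, differentiableAt_iteratedFDeriv_zero]

lemma differentiableAt_iteratedFDeriv_two :
    DifferentiableAt ℝ (iteratedFDeriv ℝ 2 f) z ↔
      DifferentiableAt ℝ (fderiv ℝ (fderiv ℝ f)) z := by
  rw [differentiableAt_iteratedFDeriv_succ, differentiableAt_iteratedFDeriv_one]

lemma norm_iteratedFDeriv_two : ‖iteratedFDeriv ℝ 2 f z‖ = ‖fderiv ℝ (fderiv ℝ f) z‖ := by
  rw [← norm_iteratedFDeriv_fderiv, norm_iteratedFDeriv_one]

set_option maxSynthPendingDepth 5 in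
set_option synthInstance.maxHeartbeats 200000 in
lemma norm_iteratedFDeriv_three :
    ‖iteratedFDeriv ℝ 3 f z‖ = ‖fderiv ℝ (fderiv ℝ (fderiv ℝ f)) z‖ := by
  rw [← norm_iteratedFDeriv_fderiv, norm_iteratedFDeriv_two]

end IteratedDerivatives

/-! ### Derivatives along lines and under the integral sign -/

lemma HasFDerivAt.hasDerivAt_line {V W : Type*} [NormedAddCommGroup V] [NormedSpace ℝ V]
    [NormedAddCommGroup W] [NormedSpace ℝ W] {f : V → W} {f' : V →L[ℝ] W} {u z : V} {t : ℝ}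
    (h : HasFDerivAt f f' (u + t • z)) : HasDerivAt (fun t : ℝ => f (u + t • z)) (f' z) t := by
  have h1 : HasDerivAt (fun t : ℝ => u + t • z) z t := by
    simpa using ((hasDerivAt_id t).smul_const z).const_add u
  exact h.comp_hasDerivAt t h1

lemma tendsto_line {V : Type*} [NormedAddCommGroup V] [NormedSpace ℝ V] (u z : V) :
    Tendsto (fun t : ℝ => u + t • z) (𝓝 0) (𝓝 u) :=
  Continuous.tendsto' (by fun_prop) _ _ (by simp)

lemma hasDerivAt_line_of_hasDerivAt_zero {V : Type*} [NormedAddCommGroup V] [NormedSpace ℝ V]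
    {f : V → ℝ} {f' : ℝ} {u z : V} {t : ℝ}
    (h : HasDerivAt (fun s : ℝ => f (u + t • z + s • z)) f' 0) :
    HasDerivAt (fun s : ℝ => f (u + s • z)) f' t := by
  have h1 : HasDerivAt (fun s : ℝ => s - t) 1 t := (hasDerivAt_id t).sub_const t
  have h2 := HasDerivAt.comp t (h₂ := fun s : ℝ => f (u + t • z + s • z)) (by simpa using h) h1
  convert! h2 using 1
  · ext s
    simp only [Function.comp]
    congr 1
    module
  · simp

lemma ContDiffAt.contDiffAt_deriv {f : ℝ → ℝ} {x : ℝ} {n m : WithTop ℕ∞}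
    (hf : ContDiffAt ℝ n f x) (hmn : m + 1 ≤ n) : ContDiffAt ℝ m (deriv f) x := by
  have : deriv f = fun y => fderiv ℝ f y 1 := by ext y; simp
  rw [this]
  exact (hf.fderiv_right hmn).clm_apply contDiffAt_const

/-- Differentiation under the integral sign along a line. -/
lemma hasDerivAt_integral_line {V 𝒳 : Type*} [NormedAddCommGroup V] [NormedSpace ℝ V]
    [MeasurableSpace 𝒳] {ν : Measure 𝒳} {F : V → 𝒳 → ℝ} {D : V → 𝒳 → ℝ} {U : Set V} (hU : IsOpen U)
    {z : V} (hint : ∀ u ∈ U, Integrable (F u) ν) {G : 𝒳 → ℝ} (hG : Integrable G ν)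
    (hF : ∀ᵐ x ∂ν, ∀ u ∈ U, HasDerivAt (fun t : ℝ => F (u + t • z) x) (D u x) 0 ∧ |D u x| ≤ G x)
    {u : V} (hu : u ∈ U) :
    Integrable (D u) ν ∧ HasDerivAt (fun t : ℝ => ∫ x, F (u + t • z) x ∂ν) (∫ x, D u x ∂ν) 0 := by
  have hs : ∀ᶠ t : ℝ in 𝓝 0, u + t • z ∈ U := (tendsto_line u z).eventually (hU.mem_nhds hu)
  have hmeas : AEStronglyMeasurable (D u) ν := by
    -- Measurability of the derivative in x is not assumed; it comes from difference quotients along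
    -- a sequence of nonzero times tending to 0.
    obtain ⟨τ, hτ, hτU⟩ := exists_seq_forall_of_frequently
      (hs.filter_mono nhdsWithin_le_nhds : ∀ᶠ t : ℝ in 𝓝[≠] 0, u + t • z ∈ U).frequently
    refine aestronglyMeasurable_of_tendsto_ae (u := atTop)
      (f := fun n x => (τ n)⁻¹ • (F (u + τ n • z) x - F u x)) (fun n => ?_) ?_
    · exact ((hint _ (hτU n)).aestronglyMeasurable.sub
        (hint _ hu).aestronglyMeasurable).const_smul ((τ n)⁻¹)
    · filter_upwards [hF] with x hx
      have := (hx u hu).1.tendsto_slope_zero.comp hτ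
      simpa [Function.comp_def] using this
  have hline : ∀ᵐ x ∂ν, ∀ t ∈ {t : ℝ | u + t • z ∈ U},
      HasDerivAt (fun t : ℝ => F (u + t • z) x) (D (u + t • z) x) t := by
    filter_upwards [hF] with x hx t ht
    exact hasDerivAt_line_of_hasDerivAt_zero (f := fun v => F v x) (hx _ ht).1
  have key := hasDerivAt_integral_of_dominated_loc_of_deriv_le (μ := ν)
    (F := fun (t : ℝ) x => F (u + t • z) x) (F' := fun (t : ℝ) x => D (u + t • z) x) (bound := G)
    hs (hs.mono fun t ht => (hint _ ht).aestronglyMeasurable) (by simpa using hint u hu)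
    (by simpa using hmeas) (by filter_upwards [hF] with x hx t ht using (hx _ ht).2) hG hline
  simpa using key

/-! ### One-variable calculus of the density ratio -/

section Ratio

variable {Φ a b : ℝ → ℝ}

/-- The first and second derivatives at `0` of `Φ'(a / b) a` and of
`(a / b) Φ'(a / b) - Φ(a / b)`, where `a 0 = b 0` and `Φ' 1 = 0`. -/
lemma hasDerivAt_ratio (hΦ : ContDiffAt ℝ 4 Φ 1) (hΦ1 : deriv Φ 1 = 0) (ha : ContDiffAt ℝ 3 a 0)
    (hb : ContDiffAt ℝ 3 b 0) (hb0 : b 0 ≠ 0) (hab : a 0 = b 0) :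
    HasDerivAt (fun t => deriv Φ (a t / b t) * a t)
      (deriv (deriv Φ) 1 * (deriv a 0 - deriv b 0)) 0 ∧
    ∃ k' : ℝ → ℝ, (∀ᶠ t in 𝓝 0,
        HasDerivAt (fun t => a t / b t * deriv Φ (a t / b t) - Φ (a t / b t)) (k' t) t) ∧
      k' 0 = deriv (deriv Φ) 1 * ((deriv a 0 - deriv b 0) / b 0) ∧
      ∀ l' : ℝ → ℝ, (∀ᶠ t in 𝓝 0, HasDerivAt (fun t => deriv Φ (a t / b t) * a t) (l' t) t) →
      ∀ l'' : ℝ, HasDerivAt l' l'' 0 → HasDerivAt k'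
        ((l'' - deriv (deriv Φ) 1 * ((deriv a 0 ^ 2 - deriv b 0 ^ 2) / b 0)) / b 0) 0 := by
  have hr0 : a 0 / b 0 = 1 := by rw [hab, div_self hb0]
  have hrc : ContDiffAt ℝ 3 (fun t => a t / b t) 0 := ha.div hb hb0
  have hr1 : Tendsto (fun t => a t / b t) (𝓝 0) (𝓝 1) := by
    have := hrc.continuousAt.tendsto; rwa [hr0] at this
  have hΦ' : ContDiffAt ℝ 3 (deriv Φ) 1 := hΦ.contDiffAt_deriv (by norm_num)
  have hdiff : ∀ {f : ℝ → ℝ} {x : ℝ}, ContDiffAt ℝ 3 f x → ∀ᶠ y in 𝓝 x, DifferentiableAt ℝ f y :=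
    fun h => (h.eventually (by simp)).mono fun y hy => hy.differentiableAt (by simp)
  have hdiff4 : ∀ᶠ y in 𝓝 (1 : ℝ), DifferentiableAt ℝ Φ y :=
    (hΦ.eventually (by simp)).mono fun y hy => hy.differentiableAt (by simp)
  set r : ℝ → ℝ := fun t => a t / b t with hr
  have hr' : ∀ᶠ t in 𝓝 0, HasDerivAt r (deriv r t) t := (hdiff hrc).mono fun t h => h.hasDerivAt
  have hrd : deriv r 0 = (deriv a 0 - deriv b 0) / b 0 := by
    have := (ha.differentiableAt (by simp)).hasDerivAt.fun_div
      (hb.differentiableAt (by simp)).hasDerivAt hb0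
    rw [this.deriv, hab]
    field_simp
  have hl : ∀ᶠ t in 𝓝 0, HasDerivAt (fun t => deriv Φ (r t) * a t)
      (deriv (deriv Φ) (r t) * deriv r t * a t + deriv Φ (r t) * deriv a t) t := by
    filter_upwards [hr', hdiff ha, hr1.eventually (hdiff hΦ')] with t h1 h2 h3
    exact (h3.hasDerivAt.comp t h1).mul h2.hasDerivAt
  have hk : ∀ᶠ t in 𝓝 0, HasDerivAt (fun t => r t * deriv Φ (r t) - Φ (r t))
      (r t * (deriv (deriv Φ) (r t) * deriv r t)) t := by
    filter_upwards [hr', hr1.eventually (hdiff hΦ'), hr1.eventually hdiff4] with t h1 h2 h3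
    convert! (h1.mul (h2.hasDerivAt.comp t h1)).sub (h3.hasDerivAt.comp t h1) using 1
    simp only [Function.comp]
    ring
  refine ⟨?_, _, hk, ?_, fun l' hl' l'' hl'' => ?_⟩
  · convert! hl.self_of_nhds using 1
    simp only [hr, hr0, hΦ1, hab]
    change _ = _ * deriv r 0 * _ + _
    rw [hrd]
    field_simp
    ring
  · simp only [hrd]
    simp [hr, hr0]
  · have hΦr : HasDerivAt (fun t => deriv Φ (r t)) (deriv (deriv Φ) 1 * deriv r 0) 0 := by
      have h1 : HasDerivAt (deriv Φ) (deriv (deriv Φ) 1) (r 0) := by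
        rw [show r 0 = 1 from hr0]; exact (hΦ'.differentiableAt (by simp)).hasDerivAt
      exact h1.comp 0 hr'.self_of_nhds
    have ha' : HasDerivAt (deriv a) (deriv (deriv a) 0) 0 :=
      ((ha.contDiffAt_deriv (m := 2) (by norm_num)).differentiableAt (by simp)).hasDerivAt
    have hb' : HasDerivAt b (deriv b 0) 0 := (hb.differentiableAt (by simp)).hasDerivAt
    have key := ((hl''.sub (hΦr.mul ha')).div hb' hb0)
    have hbne : ∀ᶠ t in 𝓝 0, b t ≠ 0 := hb.continuousAt.eventually_ne hb0
    -- With r = a/b, the derivative r Φ''(r) r' equals (l' − Φ'(r) a')/b, where l' is the derivative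
    -- of Φ'(r) a. The second derivative at 0 is thus expressed through l'' without differentiating
    -- Φ'' or r'.
    have heq : (fun t => r t * (deriv (deriv Φ) (r t) * deriv r t)) =ᶠ[𝓝 0]
        (l' - (fun t => deriv Φ (r t)) * deriv a) / b := by
      filter_upwards [hl, hl', hbne] with t h1 h2 h3
      simp only [Pi.div_apply, Pi.sub_apply, Pi.mul_apply]
      rw [h2.unique h1]
      simp only [hr]
      field_simp
      ring
    refine (key.congr_of_eventuallyEq heq).congr_deriv ?_
    have hl0 : l' 0 = deriv (deriv Φ) 1 * ((deriv a 0 - deriv b 0)) := by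
      rw [hl'.self_of_nhds.unique hl.self_of_nhds]
      simp only [hrd]
      simp only [hr, hr0, hΦ1, hab]
      field_simp
      ring
    simp only [Pi.sub_apply, Pi.mul_apply, hl0, hrd]
    simp only [hr, hr0, hΦ1]
    field_simp
    ring

end Ratio

/-! ### Derivatives of h on the diagonal, for a fixed observation -/

namespace PhiDiv

lemma IsGenerator.contDiffAt_phiReal {φ : ℝ → ℝ≥0∞} (hφ : IsGenerator φ) :
    ContDiffAt ℝ 4 (phiReal φ) 1 :=
  hφ.contDiff.contDiffAt (isOpen_interior.mem_nhds hφ.one_mem)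

/-- The point 1 is a global minimum: the real version is nonnegative even off the domain, where
`ENNReal.toReal` sends ∞ to 0. -/
lemma IsGenerator.deriv_phiReal_one {φ : ℝ → ℝ≥0∞} (hφ : IsGenerator φ) :
    deriv (phiReal φ) 1 = 0 :=
  IsLocalMin.deriv_eq_zero (Eventually.of_forall fun x => by
    simp [phiReal, hφ.map_one, ENNReal.toReal_nonneg])

variable {d : ℕ} {𝒳 : Type*} [MeasurableSpace 𝒳] {φ : ℝ → ℝ≥0∞} {ν : Measure 𝒳}
  {Θ : Set (EuclideanSpace ℝ (Fin d))} {p : EuclideanSpace ℝ (Fin d) → 𝒳 → ℝ}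

section Law

lemma integral_law (hmodel : IsModel φ ν Θ p) {θ : EuclideanSpace ℝ (Fin d)} (hθ : θ ∈ Θ)
    (f : 𝒳 → ℝ) : ∫ x, f x ∂(law ν p θ) = ∫ x, f x * p θ x ∂ν := by
  rw [law, integral_withDensity_eq_integral_toReal_smul
    (hmodel.measurable θ hθ).ennreal_ofReal (ae_of_all _ fun _ => ENNReal.ofReal_lt_top)]
  congr 1
  ext x
  rw [ENNReal.toReal_ofReal (hmodel.nonneg θ hθ x), smul_eq_mul, mul_comm]

lemma integrable_law_iff (hmodel : IsModel φ ν Θ p) {θ : EuclideanSpace ℝ (Fin d)} (hθ : θ ∈ Θ)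
    {f : 𝒳 → ℝ} : Integrable f (law ν p θ) ↔ Integrable (fun x => f x * p θ x) ν := by
  rw [law, integrable_withDensity_iff_integrable_smul' (hmodel.measurable θ hθ).ennreal_ofReal
    (ae_of_all _ fun _ => ENNReal.ofReal_lt_top)]
  refine integrable_congr (ae_of_all _ fun x => ?_)
  beta_reduce
  rw [ENNReal.toReal_ofReal (hmodel.nonneg θ hθ x), smul_eq_mul, mul_comm]

lemma ae_law_iff (hmodel : IsModel φ ν Θ p) {θ : EuclideanSpace ℝ (Fin d)} (hθ : θ ∈ Θ)
    {q : 𝒳 → Prop} : (∀ᵐ x ∂(law ν p θ), q x) ↔ ∀ᵐ x ∂ν, 0 < p θ x → q x := by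
  rw [law, ae_withDensity_iff (hmodel.measurable θ hθ).ennreal_ofReal]
  simp

lemma integral_density (hmodel : IsModel φ ν Θ p) {θ : EuclideanSpace ℝ (Fin d)} (hθ : θ ∈ Θ) :
    Integrable (p θ) ν ∧ ∫ x, p θ x ∂ν = 1 := by
  have := hmodel.isProbabilityMeasure θ hθ
  have h1 := (integrable_law_iff hmodel hθ).1 (integrable_const (1 : ℝ))
  have h2 := integral_law hmodel hθ fun _ => 1
  simp only [one_mul] at h1 h2
  exact ⟨h1, by simpa using h2.symm⟩

end Law

/-- The integrand `f(θ, α, x) p_θ(x)` as a function of the pair `(θ, α)`. -/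
noncomputable def fpFun (φ : ℝ → ℝ≥0∞) (p : EuclideanSpace ℝ (Fin d) → 𝒳 → ℝ)
    (w : EuclideanSpace ℝ (Fin d) × EuclideanSpace ℝ (Fin d)) (x : 𝒳) : ℝ :=
  fFun φ p w.1 w.2 x * p w.1 x

/-- The function `h(θ, α, x)` as a function of the pair `(θ, α)`. -/
noncomputable def hPair (φ : ℝ → ℝ≥0∞) (ν : Measure 𝒳) (p : EuclideanSpace ℝ (Fin d) → 𝒳 → ℝ)
    (w : EuclideanSpace ℝ (Fin d) × EuclideanSpace ℝ (Fin d)) (x : 𝒳) : ℝ :=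
  hFun φ ν p w.1 w.2 x

/-- The derivative of the density in the direction `v`. -/
noncomputable def dDensity {𝒴 : Type*} (p : EuclideanSpace ℝ (Fin d) → 𝒴 → ℝ)
    (θ v : EuclideanSpace ℝ (Fin d)) (x : 𝒴) : ℝ :=
  fderiv ℝ (fun θ' => p θ' x) θ v

/-- Rewriting the integral over the fixed measure ν leaves θ and α in the integrand only, so that it
can be differentiated under the integral sign. -/
lemma hPair_eq (hmodel : IsModel φ ν Θ p)
    {w : EuclideanSpace ℝ (Fin d) × EuclideanSpace ℝ (Fin d)} (hw : w.1 ∈ Θ) (x : 𝒳) :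
    hPair φ ν p w x = ∫ y, fpFun φ p w y ∂ν - gFun φ p w.1 w.2 x := by
  rw [hPair, hFun, integral_law hmodel hw]
  rfl

lemma dDensity_eq_zero {𝒴 : Type*} {p : EuclideanSpace ℝ (Fin d) → 𝒴 → ℝ} {x : 𝒴}
    {θ : EuclideanSpace ℝ (Fin d)} (h : ∀ᶠ θ' in 𝓝 θ, p θ' x = 0) (v : EuclideanSpace ℝ (Fin d)) :
    dDensity p θ v x = 0 := by
  rw [dDensity, Filter.EventuallyEq.fderiv_eq (f := fun _ => (0 : ℝ)) h]
  simp

lemma fpFun_eventuallyEq_zero {𝒴 : Type*} {p : EuclideanSpace ℝ (Fin d) → 𝒴 → ℝ} {x : 𝒴}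
    {θ : EuclideanSpace ℝ (Fin d)} (h : ∀ᶠ θ' in 𝓝 θ, p θ' x = 0) (α : EuclideanSpace ℝ (Fin d)) :
    (fun u => fpFun φ p u x) =ᶠ[𝓝 (θ, α)] fun _ => 0 := by
  filter_upwards [(continuous_fst.tendsto (θ, α)).eventually h] with u hu
  simp [fpFun, hu]

section Pointwise

variable {θ v w : EuclideanSpace ℝ (Fin d)} {x : 𝒳}

lemma contDiffAt_density_line {𝒴 : Type*} {p : EuclideanSpace ℝ (Fin d) → 𝒴 → ℝ} {x : 𝒴}
    (hC : ContDiffAt ℝ 3 (fun θ' => p θ' x) θ) :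
    ContDiffAt ℝ 3 (fun t : ℝ => p (θ + t • v) x) 0 := by
  have h1 : ContDiffAt ℝ 3 (fun t : ℝ => θ + t • v) 0 := by fun_prop
  exact ContDiffAt.comp (0 : ℝ) (g := fun θ' => p θ' x) (by simpa using hC) h1

lemma deriv_density_line {𝒴 : Type*} {p : EuclideanSpace ℝ (Fin d) → 𝒴 → ℝ} {x : 𝒴}
    (hC : ContDiffAt ℝ 3 (fun θ' => p θ' x) θ) :
    deriv (fun t : ℝ => p (θ + t • v) x) 0 = dDensity p θ v x := by
  have h := (hC.differentiableAt (by simp)).hasFDerivAt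
  rw [← add_zero θ, ← zero_smul ℝ v] at h
  simpa [dDensity] using h.hasDerivAt_line.deriv

/-- The derivative of `f(θ, α, x) p_θ(x)` on the diagonal. -/
lemma fderiv_fpFun_diag {𝒴 : Type*} {p : EuclideanSpace ℝ (Fin d) → 𝒴 → ℝ} {x : 𝒴}
    (hφ : IsGenerator φ) (hC : ContDiffAt ℝ 3 (fun θ' => p θ' x) θ)
    (hp : p θ x ≠ 0 ∨ ∀ᶠ θ' in 𝓝 θ, p θ' x = 0)
    (hd : DifferentiableAt ℝ (fun u => fpFun φ p u x) (θ, θ)) :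
    fderiv ℝ (fun u => fpFun φ p u x) (θ, θ) (v, w) =
      deriv (dphi φ) 1 * (dDensity p θ v x - dDensity p θ w x) := by
  have hline : HasDerivAt (fun t : ℝ => fpFun φ p ((θ, θ) + t • (v, w)) x)
      (fderiv ℝ (fun u => fpFun φ p u x) (θ, θ) (v, w)) 0 := by
    have h := hd.hasFDerivAt
    have e : ((θ, θ) : EuclideanSpace ℝ (Fin d) × EuclideanSpace ℝ (Fin d)) =
      (θ, θ) + (0 : ℝ) • (v, w) := by simp
    rw [e] at h
    simpa using h.hasDerivAt_line
  rcases hp with hp | hp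
  · have h := (hasDerivAt_ratio hφ.contDiffAt_phiReal hφ.deriv_phiReal_one
      (contDiffAt_density_line (v := v) hC) (contDiffAt_density_line (v := w) hC)
      (by simpa using hp) (by simp)).1
    rw [deriv_density_line hC, deriv_density_line hC] at h
    exact hline.unique h
  · rw [(fpFun_eventuallyEq_zero hp θ).fderiv_eq, dDensity_eq_zero hp, dDensity_eq_zero hp]
    simp

/-- First and second derivatives of `h` at a point of the diagonal, in terms of those of
`f(θ, α, x) p_θ(x)`. -/
lemma fderiv_hPair_diag (hφ : IsGenerator φ) (hmodel : IsModel φ ν Θ p) (hθ : θ ∈ interior Θ)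
    (hC : ContDiffAt ℝ 3 (fun θ' => p θ' x) θ) (hp : p θ x ≠ 0)
    {U : Set (EuclideanSpace ℝ (Fin d) × EuclideanSpace ℝ (Fin d))} (hU : IsOpen U)
    (hθU : (θ, θ) ∈ U)
    (hF : ∀ u ∈ U, DifferentiableAt ℝ (fun u => fpFun φ p u x) u)
    (hF2 : DifferentiableAt ℝ (fderiv ℝ fun u => fpFun φ p u x) (θ, θ))
    (hh : ∀ u ∈ U, DifferentiableAt ℝ (fun u => hPair φ ν p u x) u)
    (hh2 : DifferentiableAt ℝ (fderiv ℝ fun u => hPair φ ν p u x) (θ, θ))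
    {A' : EuclideanSpace ℝ (Fin d) × EuclideanSpace ℝ (Fin d) → ℝ} {A'' : ℝ}
    (hA' : ∀ u ∈ U, HasDerivAt (fun t : ℝ => ∫ y, fpFun φ p (u + t • (v, w)) y ∂ν) (A' u) 0)
    (hA'' : HasDerivAt (fun t : ℝ => A' ((θ, θ) + t • (v, w))) A'' 0) :
    fderiv ℝ (fun u => hPair φ ν p u x) (θ, θ) (v, w) = A' (θ, θ) -
      deriv (dphi φ) 1 * ((dDensity p θ v x - dDensity p θ w x) / p θ x) ∧
    fderiv ℝ (fderiv ℝ fun u => hPair φ ν p u x) (θ, θ) (v, w) (v, w) = A'' -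
      (fderiv ℝ (fderiv ℝ fun u => fpFun φ p u x) (θ, θ) (v, w) (v, w) -
        deriv (dphi φ) 1 * ((dDensity p θ v x ^ 2 - dDensity p θ w x ^ 2) / p θ x)) / p θ x := by
  have e : ((θ, θ) : EuclideanSpace ℝ (Fin d) × EuclideanSpace ℝ (Fin d)) =
    (θ, θ) + (0 : ℝ) • (v, w) := by simp
  have hUt : ∀ᶠ t : ℝ in 𝓝 0, (θ, θ) + t • (v, w) ∈ U :=
    (tendsto_line (θ, θ) (v, w)).eventually (hU.mem_nhds hθU)
  have hΘt : ∀ᶠ t : ℝ in 𝓝 0, θ + t • v ∈ Θ :=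
    (tendsto_line θ v).eventually (mem_interior_iff_mem_nhds.1 hθ)
  obtain ⟨-, k', hk', hk0, hk2⟩ := hasDerivAt_ratio hφ.contDiffAt_phiReal hφ.deriv_phiReal_one
      (contDiffAt_density_line (v := v) hC) (contDiffAt_density_line (v := w) hC)
      (by simpa using hp) (by simp)
  have hk2 := hk2 (fun t => fderiv ℝ (fun u => fpFun φ p u x) ((θ, θ) + t • (v, w)) (v, w))
    (hUt.mono fun t ht => (hF _ ht).hasFDerivAt.hasDerivAt_line) _ (by
      have h := hF2.hasFDerivAt
      rw [e] at h
      exact h.hasDerivAt_line.clm_apply (hasDerivAt_const 0 (v, w)))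
  simp only [deriv_density_line hC] at hk0 hk2
  -- The first-order formula is needed at all small t, not only on the diagonal, in order to be
  -- differentiated once more.
  have hfirst : ∀ᶠ t : ℝ in 𝓝 0, fderiv ℝ (fun u => hPair φ ν p u x) ((θ, θ) + t • (v, w)) (v, w) =
      A' ((θ, θ) + t • (v, w)) - k' t := by
    filter_upwards [hk', hUt, hΘt.eventually_nhds] with t h1 h2 h3
    have hA := hasDerivAt_line_of_hasDerivAt_zero (f := fun u => ∫ y, fpFun φ p u y ∂ν) (hA' _ h2)
    have h4 := (hh _ h2).hasFDerivAt.hasDerivAt_line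
    refine h4.unique ((hA.sub h1).congr_of_eventuallyEq ?_)
    filter_upwards [h3] with s hs
    exact hPair_eq hmodel hs x
  constructor
  · simpa [hk0, dphi] using hfirst.self_of_nhds
  · have h := hh2.hasFDerivAt
    rw [e] at h
    have h1 := (h.hasDerivAt_line.clm_apply (hasDerivAt_const 0 (v, w))).unique
      ((hA''.sub hk2).congr_of_eventuallyEq hfirst)
    simpa [dphi] using h1

end Pointwise

end PhiDiv

/-! ### The score, its moments and the Fisher information -/

namespace PhiDiv

variable {d : ℕ} {𝒳 : Type*} [MeasurableSpace 𝒳] {φ : ℝ → ℝ≥0∞} {ν : Measure 𝒳}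
  {Θ : Set (EuclideanSpace ℝ (Fin d))} {p : EuclideanSpace ℝ (Fin d) → 𝒳 → ℝ}

/-- The score `p'_θ / p_θ`, as a vector. -/
noncomputable def score {𝒴 : Type*} (p : EuclideanSpace ℝ (Fin d) → 𝒴 → ℝ)
    (θ : EuclideanSpace ℝ (Fin d)) (x : 𝒴) : EuclideanSpace ℝ (Fin d) :=
  WithLp.toLp 2 fun i => dDensity p θ (EuclideanSpace.single i 1) x / p θ x

lemma inner_score {𝒴 : Type*} (p : EuclideanSpace ℝ (Fin d) → 𝒴 → ℝ)
    (θ v : EuclideanSpace ℝ (Fin d)) (x : 𝒴) :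
    inner ℝ v (score p θ x) = dDensity p θ v x / p θ x := by
  have hv : v = ∑ i, v i • EuclideanSpace.single i (1 : ℝ) := by
    simpa using ((EuclideanSpace.basisFun (Fin d) ℝ).sum_repr v).symm
  conv_rhs => rw [hv]
  simp [score, dDensity, PiLp.inner_apply, Finset.sum_div]
  exact Finset.sum_congr rfl fun i _ => by ring

lemma DominatedDeriv.one {F : EuclideanSpace ℝ (Fin d) → EuclideanSpace ℝ (Fin d) → 𝒳 → ℝ}
    {N : Set (EuclideanSpace ℝ (Fin d))} {m : Measure 𝒳} (h : DominatedDeriv 1 F N m) :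
    ∃ G : 𝒳 → ℝ, Integrable G m ∧ ∀ᵐ x ∂m, ∀ u ∈ N ×ˢ N,
      DifferentiableAt ℝ (fun u : _ × _ => F u.1 u.2 x) u ∧
      ‖fderiv ℝ (fun u : _ × _ => F u.1 u.2 x) u‖ ≤ G x := by
  obtain ⟨G, hG, h⟩ := h
  refine ⟨G, hG, h.mono fun x hx u hu => ⟨?_, ?_⟩⟩
  · exact differentiableAt_iteratedFDeriv_zero.1 ((hx u hu).1 0 (by norm_num))
  · rw [← norm_iteratedFDeriv_one]; exact (hx u hu).2

lemma DominatedDeriv.two {F : EuclideanSpace ℝ (Fin d) → EuclideanSpace ℝ (Fin d) → 𝒳 → ℝ}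
    {N : Set (EuclideanSpace ℝ (Fin d))} {m : Measure 𝒳} (h : DominatedDeriv 2 F N m) :
    ∃ G : 𝒳 → ℝ, Integrable G m ∧ ∀ᵐ x ∂m, ∀ u ∈ N ×ˢ N,
      DifferentiableAt ℝ (fderiv ℝ (fun u : _ × _ => F u.1 u.2 x)) u ∧
      ‖fderiv ℝ (fderiv ℝ (fun u : _ × _ => F u.1 u.2 x)) u‖ ≤ G x := by
  obtain ⟨G, hG, h⟩ := h
  refine ⟨G, hG, h.mono fun x hx u hu => ⟨?_, ?_⟩⟩
  · exact differentiableAt_iteratedFDeriv_one.1 ((hx u hu).1 1 (by norm_num))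
  · rw [← norm_iteratedFDeriv_two]; exact (hx u hu).2

-- By the mean value inequality on convex sets, the bound on third derivatives becomes a Lipschitz
-- bound on second derivatives, the only form in which it is used.
set_option maxSynthPendingDepth 5 in
set_option synthInstance.maxHeartbeats 200000 in
lemma DominatedDeriv.three {F : EuclideanSpace ℝ (Fin d) → EuclideanSpace ℝ (Fin d) → 𝒳 → ℝ}
    {N : Set (EuclideanSpace ℝ (Fin d))} {m : Measure 𝒳} (h : DominatedDeriv 3 F N m) :
    ∃ G : 𝒳 → ℝ, Integrable G m ∧ ∀ᵐ x ∂m,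
      (∀ u ∈ N ×ˢ N, DifferentiableAt ℝ (fun u : _ × _ => F u.1 u.2 x) u) ∧
      (∀ u ∈ N ×ˢ N, DifferentiableAt ℝ (fderiv ℝ (fun u : _ × _ => F u.1 u.2 x)) u) ∧
      ∀ s ⊆ N ×ˢ N, Convex ℝ s → ∀ u ∈ s, ∀ u' ∈ s,
        ‖fderiv ℝ (fderiv ℝ (fun u : _ × _ => F u.1 u.2 x)) u -
          fderiv ℝ (fderiv ℝ (fun u : _ × _ => F u.1 u.2 x)) u'‖ ≤ G x * ‖u - u'‖ := by
  obtain ⟨G, hG, h⟩ := h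
  refine ⟨G, hG, h.mono fun x hx => ⟨fun u hu => ?_, fun u hu => ?_, fun s hs hc u hu u' hu' => ?_⟩⟩
  · exact differentiableAt_iteratedFDeriv_zero.1 ((hx u hu).1 0 (by norm_num))
  · exact differentiableAt_iteratedFDeriv_one.1 ((hx u hu).1 1 (by norm_num))
  · refine hc.norm_image_sub_le_of_norm_fderiv_le (𝕜 := ℝ) (fun y hy => ?_) (fun y hy => ?_) hu' hu
    · exact differentiableAt_iteratedFDeriv_two.1 ((hx y (hs hy)).1 2 (by norm_num))
    · rw [← norm_iteratedFDeriv_three]; exact (hx y (hs hy)).2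

/-- The common support gives a dichotomy for almost every x: the density is nonzero at θ, so ratios
can be differentiated, or it vanishes near θ and so do all derivatives involved. -/
lemma IsModel.ae_regular (hmodel : IsModel φ ν Θ p) {N : Set (EuclideanSpace ℝ (Fin d))}
    (hN : IsOpen N) (hNΘ : N ⊆ Θ) : ∀ᵐ x ∂ν, ∀ θ ∈ N, ContDiffAt ℝ 3 (fun θ' => p θ' x) θ ∧
      (p θ x ≠ 0 ∨ ∀ᶠ θ' in 𝓝 θ, p θ' x = 0) := by
  filter_upwards [hmodel.contDiff, hmodel.support] with x h1 h2 θ hθ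
  have hmem : θ ∈ interior Θ := interior_maximal hNΘ hN hθ
  refine ⟨h1.contDiffAt (isOpen_interior.mem_nhds hmem), ?_⟩
  rcases h2 with h2 | h2
  · exact Or.inl (h2 θ (hNΘ hθ)).ne'
  · exact Or.inr (Filter.eventually_of_mem (mem_interior_iff_mem_nhds.1 hmem) h2)

lemma integrable_fpFun (hmodel : IsModel φ ν Θ p)
    {u : EuclideanSpace ℝ (Fin d) × EuclideanSpace ℝ (Fin d)} (h1 : u.1 ∈ Θ) (h2 : u.2 ∈ Θ) :
    Integrable (fpFun φ p u) ν :=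
  (integrable_law_iff hmodel h1).1 (hmodel.integrable _ h1 _ h2)

section Local

variable {N : Set (EuclideanSpace ℝ (Fin d))} {θ : EuclideanSpace ℝ (Fin d)}

/-- The derivative of the density integrates to zero. -/
lemma integral_dDensity (hφ : IsGenerator φ) (hφ2 : deriv (dphi φ) 1 ≠ 0)
    (hmodel : IsModel φ ν Θ p) (hN : IsOpen N) (hNΘ : N ⊆ Θ)
    (hD1 : DominatedDeriv 1 (fun θ α x => fFun φ p θ α x * p θ x) N ν) (hθ : θ ∈ N)
    (v : EuclideanSpace ℝ (Fin d)) :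
    Integrable (dDensity p θ v) ν ∧ ∫ x, dDensity p θ v x ∂ν = 0 := by
  obtain ⟨G, hG, hD⟩ := hD1.one
  have key := hasDerivAt_integral_line (F := p) (D := fun θ x => dDensity p θ v x) hN (z := v)
    (fun u hu => (integral_density hmodel (hNΘ hu)).1)
    (hG.mul_const (‖(v, (0 : EuclideanSpace ℝ (Fin d)))‖ / |deriv (dphi φ) 1|)) (by
      filter_upwards [hmodel.ae_regular hN hNΘ, hD] with x hx hDx u hu
      constructor
      · have h := ((hx u hu).1.differentiableAt (by simp)).hasFDerivAt
        rw [← add_zero u, ← zero_smul ℝ v] at h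
        simpa [dDensity] using h.hasDerivAt_line
      -- No domination of p' is assumed. In direction (v, 0) the diagonal derivative of f p_θ is c
      -- D_v p with c ≠ 0, so the bound for f p_θ dominates p'.
      · have h1 := fderiv_fpFun_diag (v := v) (w := 0) hφ (hx u hu).1 (hx u hu).2
          (hDx (u, u) ⟨hu, hu⟩).1
        have h2 : dDensity p u 0 x = 0 := by simp [dDensity]
        rw [h2, sub_zero] at h1
        have h3 := ContinuousLinearMap.le_of_opNorm_le _ (hDx (u, u) ⟨hu, hu⟩).2 (v, 0)
        have h4 : |deriv (dphi φ) 1| * |dDensity p u v x| ≤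
            G x * ‖(v, (0 : EuclideanSpace ℝ (Fin d)))‖ := by
          rw [← abs_mul, ← h1]
          exact h3
        rw [mul_div_assoc', le_div_iff₀ (abs_pos.2 hφ2), mul_comm]
        exact h4) hθ
  -- Near θ the integral of the density is constantly 1, so its derivative is 0.
  refine ⟨key.1, key.2.unique ((hasDerivAt_const (0 : ℝ) (1 : ℝ)).congr_of_eventuallyEq ?_)⟩
  filter_upwards [(tendsto_line θ v).eventually (hN.mem_nhds hθ)] with t ht
  exact (integral_density hmodel (hNΘ ht)).2

lemma law_absolutelyContinuous : law ν p θ ≪ ν := withDensity_absolutelyContinuous _ _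

lemma aestronglyMeasurable_inner_score (hφ : IsGenerator φ) (hφ2 : deriv (dphi φ) 1 ≠ 0)
    (hmodel : IsModel φ ν Θ p) (hN : IsOpen N) (hNΘ : N ⊆ Θ)
    (hD1 : DominatedDeriv 1 (fun θ α x => fFun φ p θ α x * p θ x) N ν) (hθ : θ ∈ N)
    (v : EuclideanSpace ℝ (Fin d)) :
    AEStronglyMeasurable (fun x => inner ℝ v (score p θ x)) (law ν p θ) := by
  simp only [inner_score]
  have h := ((integral_dDensity hφ hφ2 hmodel hN hNΘ hD1 hθ v).1.aestronglyMeasurable.mono_ac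
    (law_absolutelyContinuous (p := p) (θ := θ)))
  exact (h.aemeasurable.div (hmodel.measurable θ (hNΘ hθ)).aemeasurable).aestronglyMeasurable

lemma integral_inner_score (hφ : IsGenerator φ) (hφ2 : deriv (dphi φ) 1 ≠ 0)
    (hmodel : IsModel φ ν Θ p) (hN : IsOpen N) (hNΘ : N ⊆ Θ)
    (hD1 : DominatedDeriv 1 (fun θ α x => fFun φ p θ α x * p θ x) N ν) (hθ : θ ∈ N)
    (v : EuclideanSpace ℝ (Fin d)) : ∫ x, inner ℝ v (score p θ x) ∂(law ν p θ) = 0 := by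
  rw [integral_law hmodel (hNΘ hθ), ← (integral_dDensity hφ hφ2 hmodel hN hNΘ hD1 hθ v).2]
  refine integral_congr_ae ?_
  filter_upwards [hmodel.ae_regular hN hNΘ] with x hx
  rw [inner_score]
  rcases (hx θ hθ).2 with h | h
  · field_simp
  · simp [dDensity_eq_zero h]

/-- The derivative of `h` at a point of the diagonal is given by the score; its second derivative
is integrable, with an integral given by the second moments of the score. -/
lemma derivs_hPair (hφ : IsGenerator φ) (hφ2 : deriv (dphi φ) 1 ≠ 0)
    (hmodel : IsModel φ ν Θ p) (hN : IsOpen N) (hNΘ : N ⊆ Θ)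
    (hD1 : DominatedDeriv 1 (fun θ α x => fFun φ p θ α x * p θ x) N ν)
    (hD2 : DominatedDeriv 2 (fun θ α x => fFun φ p θ α x * p θ x) N ν)
    (hD3 : DominatedDeriv 3 (hFun φ ν p) N (law ν p θ)) (hθ : θ ∈ N)
    (v w : EuclideanSpace ℝ (Fin d)) :
    (∀ᵐ x ∂(law ν p θ), fderiv ℝ (fun u => hPair φ ν p u x) (θ, θ) (v, w) =
      -(deriv (dphi φ) 1 * inner ℝ (v - w) (score p θ x))) ∧
    ((∀ v, MemLp (fun x => inner ℝ v (score p θ x)) 2 (law ν p θ)) →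
      Integrable (fun x => fderiv ℝ (fderiv ℝ fun u => hPair φ ν p u x) (θ, θ) (v, w) (v, w))
        (law ν p θ) ∧
      ∫ x, fderiv ℝ (fderiv ℝ fun u => hPair φ ν p u x) (θ, θ) (v, w) (v, w) ∂(law ν p θ) =
        deriv (dphi φ) 1 * (∫ x, (inner ℝ v (score p θ x)) ^ 2 ∂(law ν p θ) -
          ∫ x, (inner ℝ w (score p θ x)) ^ 2 ∂(law ν p θ))) := by
  have hθΘ := hNΘ hθ
  have hprob := hmodel.isProbabilityMeasure θ hθΘ
  obtain ⟨G₁, hG₁, hF₁⟩ := hD1.one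
  obtain ⟨G₂, hG₂, hF₂⟩ := hD2.two
  obtain ⟨G₃, hG₃, hF₃⟩ := hD3.three
  have hU : IsOpen (N ×ˢ N) := hN.prod hN
  have hθU : (θ, θ) ∈ N ×ˢ N := ⟨hθ, hθ⟩
  have hA' := fun u (hu : u ∈ N ×ˢ N) => hasDerivAt_integral_line (ν := ν)
    (F := fpFun φ p) (D := fun u x => fderiv ℝ (fun u => fpFun φ p u x) u (v, w)) hU (z := (v, w))
    (fun u hu => integrable_fpFun hmodel (hNΘ hu.1) (hNΘ hu.2)) (hG₁.mul_const ‖(v, w)‖) (by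
      filter_upwards [hF₁] with x hx u hu
      refine ⟨?_, ContinuousLinearMap.le_of_opNorm_le _ (hx u hu).2 _⟩
      have h := (hx u hu).1.hasFDerivAt
      rw [← add_zero u, ← zero_smul ℝ (v, w)] at h
      simpa [fpFun] using h.hasDerivAt_line) hu
  have hA'' := hasDerivAt_integral_line (ν := ν)
    (F := fun u x => fderiv ℝ (fun u => fpFun φ p u x) u (v, w))
    (D := fun u x => fderiv ℝ (fderiv ℝ fun u => fpFun φ p u x) u (v, w) (v, w)) hU (z := (v, w))
    (fun u hu => (hA' u hu).1) ((hG₂.mul_const ‖(v, w)‖).mul_const ‖(v, w)‖) (by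
      filter_upwards [hF₂] with x hx u hu
      refine ⟨?_, ContinuousLinearMap.le_of_opNorm_le _
        (ContinuousLinearMap.le_of_opNorm_le _ (hx u hu).2 _) _⟩
      have h := (hx u hu).1.hasFDerivAt
      rw [← add_zero u, ← zero_smul ℝ (v, w)] at h
      simpa [fpFun] using h.hasDerivAt_line.clm_apply (hasDerivAt_const 0 (v, w))) hθU
  -- The deterministic part of the first derivative of h vanishes, because the derivatives of the
  -- density integrate to zero.
  have hA'0 : ∫ x, fderiv ℝ (fun u => fpFun φ p u x) (θ, θ) (v, w) ∂ν = 0 := by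
    have hv := integral_dDensity hφ hφ2 hmodel hN hNΘ hD1 hθ v
    have hw := integral_dDensity hφ hφ2 hmodel hN hNΘ hD1 hθ w
    calc _ = ∫ x, deriv (dphi φ) 1 * (dDensity p θ v x - dDensity p θ w x) ∂ν := by
          refine integral_congr_ae ?_
          filter_upwards [hmodel.ae_regular hN hNΘ, hF₁] with x hx hFx
          exact fderiv_fpFun_diag hφ (hx θ hθ).1 (hx θ hθ).2 (hFx _ hθU).1
      _ = 0 := by rw [integral_const_mul, integral_sub hv.1 hw.1, hv.2, hw.2]; simp
  have hboth : ∀ᵐ x ∂(law ν p θ), p θ x ≠ 0 ∧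
      fderiv ℝ (fun u => hPair φ ν p u x) (θ, θ) (v, w) =
        ∫ x, fderiv ℝ (fun u => fpFun φ p u x) (θ, θ) (v, w) ∂ν -
        deriv (dphi φ) 1 * ((dDensity p θ v x - dDensity p θ w x) / p θ x) ∧
      fderiv ℝ (fderiv ℝ fun u => hPair φ ν p u x) (θ, θ) (v, w) (v, w) =
        ∫ x, fderiv ℝ (fderiv ℝ fun u => fpFun φ p u x) (θ, θ) (v, w) (v, w) ∂ν -
        (fderiv ℝ (fderiv ℝ fun u => fpFun φ p u x) (θ, θ) (v, w) (v, w) - deriv (dphi φ) 1 *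
          ((dDensity p θ v x ^ 2 - dDensity p θ w x ^ 2) / p θ x)) / p θ x := by
    filter_upwards [(ae_law_iff hmodel hθΘ).2 (ae_of_all ν fun x h => h),
      law_absolutelyContinuous.ae_le (hmodel.ae_regular hN hNΘ),
      law_absolutelyContinuous.ae_le hF₁, law_absolutelyContinuous.ae_le hF₂, hF₃]
      with x hpos hx hx1 hx2 hx3
    exact ⟨hpos.ne', fderiv_hPair_diag (v := v) (w := w) hφ hmodel (interior_maximal hNΘ hN hθ)
      (hx θ hθ).1 hpos.ne' hU hθU (fun u hu => (hx1 u hu).1) (hx2 _ hθU).1 hx3.1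
      (hx3.2.1 _ hθU) (fun u hu => (hA' u hu).2) hA''.2⟩
  refine ⟨?_, fun hL2 => ?_⟩
  · filter_upwards [hboth] with x hx
    rw [hx.2.1, hA'0, inner_sub_left, inner_score, inner_score]
    ring
  · set A₂ := ∫ x, fderiv ℝ (fderiv ℝ fun u => fpFun φ p u x) (θ, θ) (v, w) (v, w) ∂ν with hA₂
    have hcongr : (fun x => fderiv ℝ (fderiv ℝ fun u => hPair φ ν p u x) (θ, θ) (v, w) (v, w))
        =ᵐ[law ν p θ] fun x => A₂ -
          fderiv ℝ (fderiv ℝ fun u => fpFun φ p u x) (θ, θ) (v, w) (v, w) / p θ x +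
          deriv (dphi φ) 1 * (inner ℝ v (score p θ x) ^ 2 - inner ℝ w (score p θ x) ^ 2) := by
      filter_upwards [hboth] with x hx
      have := hx.1
      rw [hx.2.2, inner_score, inner_score]
      field_simp
      ring
    -- Under P_θ the division by p_θ is undone by the density; where p_θ = 0 the second derivative
    -- vanishes too. This term then cancels A₂ in expectation, leaving only second moments of the
    -- score.
    have hmul : (fun x => fderiv ℝ (fderiv ℝ fun u => fpFun φ p u x) (θ, θ) (v, w) (v, w) /
        p θ x * p θ x) =ᵐ[ν]
        fun x => fderiv ℝ (fderiv ℝ fun u => fpFun φ p u x) (θ, θ) (v, w) (v, w) := by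
      filter_upwards [hmodel.ae_regular hN hNΘ] with x hx
      rcases (hx θ hθ).2 with h | h
      · field_simp
      · have h0 := (fpFun_eventuallyEq_zero (φ := φ) h θ).fderiv (𝕜 := ℝ)
        have h1 := h0.fderiv_eq (𝕜 := ℝ)
        rw [h1]
        simp
    have hi1 : Integrable (fun x => fderiv ℝ (fderiv ℝ fun u => fpFun φ p u x) (θ, θ)
        (v, w) (v, w) / p θ x) (law ν p θ) :=
      (integrable_law_iff hmodel hθΘ).2 (hA''.1.congr hmul.symm)
    have hi2 := (hL2 v).integrable_sq
    have hi3 := (hL2 w).integrable_sq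
    have hi4 : Integrable (fun x => deriv (dphi φ) 1 *
        (inner ℝ v (score p θ x) ^ 2 - inner ℝ w (score p θ x) ^ 2)) (law ν p θ) :=
      (hi2.sub hi3).const_mul _
    have hi5 : Integrable (fun x => A₂ - fderiv ℝ (fderiv ℝ fun u => fpFun φ p u x) (θ, θ)
        (v, w) (v, w) / p θ x) (law ν p θ) := (integrable_const A₂).sub hi1
    refine ⟨(hi5.add hi4).congr hcongr.symm, ?_⟩
    rw [integral_congr_ae hcongr, integral_add hi5 hi4, integral_sub (integrable_const _) hi1,
      integral_const_mul, integral_sub hi2 hi3, integral_law hmodel hθΘ (fun x => _ / _),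
      integral_congr_ae hmul, ← hA₂]
    simp

/-- The score is square integrable as soon as the derivative of `h` with respect to `α` is. -/
lemma memLp_inner_score (hφ : IsGenerator φ) (hφ2 : deriv (dphi φ) 1 ≠ 0)
    (hmodel : IsModel φ ν Θ p) (hN : IsOpen N) (hNΘ : N ⊆ Θ)
    (hD1 : DominatedDeriv 1 (fun θ α x => fFun φ p θ α x * p θ x) N ν)
    (hD2 : DominatedDeriv 2 (fun θ α x => fFun φ p θ α x * p θ x) N ν)
    (hD3 : DominatedDeriv 3 (hFun φ ν p) N (law ν p θ)) (hθ : θ ∈ N)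
    (hα : Integrable (fun x => ‖fderiv ℝ (fun α => hFun φ ν p θ α x) θ‖ ^ 2) (law ν p θ))
    (v : EuclideanSpace ℝ (Fin d)) : MemLp (fun x => inner ℝ v (score p θ x)) 2 (law ν p θ) := by
  have hm := aestronglyMeasurable_inner_score hφ hφ2 hmodel hN hNΘ hD1 hθ v
  obtain ⟨G₃, hG₃, hF₃⟩ := hD3.three
  refine (memLp_two_iff_integrable_sq hm).2 ((hα.const_mul
    ((deriv (dphi φ) 1)⁻¹ ^ 2 * ‖v‖ ^ 2)).mono' (hm.pow 2) ?_)
  -- The direction (0, v) isolates the α-derivative of h, which is c times the score.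
  filter_upwards [(derivs_hPair hφ hφ2 hmodel hN hNΘ hD1 hD2 hD3 hθ 0 v).1, hF₃] with x hx hx3
  have h1 : HasFDerivAt (fun α => hFun φ ν p θ α x)
      ((fderiv ℝ (fun u => hPair φ ν p u x) (θ, θ)).comp (ContinuousLinearMap.inr ℝ _ _)) θ :=
    (hx3.1 (θ, θ) ⟨hθ, hθ⟩).hasFDerivAt.comp θ (hasFDerivAt_prodMk_right θ θ)
  have h2 : fderiv ℝ (fun α => hFun φ ν p θ α x) θ v =
      deriv (dphi φ) 1 * inner ℝ v (score p θ x) := by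
    rw [h1.fderiv]
    simpa [inner_neg_left] using hx
  have h3 := ContinuousLinearMap.le_opNorm (fderiv ℝ (fun α => hFun φ ν p θ α x) θ) v
  rw [h2, norm_mul] at h3
  have h4 : ‖deriv (dphi φ) 1‖⁻¹ * (‖deriv (dphi φ) 1‖ * ‖inner ℝ v (score p θ x)‖) =
      ‖inner ℝ v (score p θ x)‖ := by
    have : ‖deriv (dphi φ) 1‖ ≠ 0 := by simpa using hφ2
    field_simp
  calc ‖inner ℝ v (score p θ x) ^ 2‖ = ‖inner ℝ v (score p θ x)‖ ^ 2 := norm_pow _ _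
    _ ≤ (‖deriv (dphi φ) 1‖⁻¹ * (‖fderiv ℝ (fun α => hFun φ ν p θ α x) θ‖ * ‖v‖)) ^ 2 := by
        rw [← h4]; gcongr
    _ = _ := by
        rw [mul_pow, mul_pow, ← norm_inv, Real.norm_eq_abs, sq_abs]
        ring

/-- The Fisher information matrix is the matrix of second moments of the score. -/
lemma dotProduct_fisher_mulVec (hmodel : IsModel φ ν Θ p) (hθ : θ ∈ Θ)
    (hL2 : ∀ v, MemLp (fun x => inner ℝ v (score p θ x)) 2 (law ν p θ))
    (v w : EuclideanSpace ℝ (Fin d)) : v.ofLp ⬝ᵥ (fisher ν p θ).mulVec w.ofLp =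
      ∫ x, inner ℝ v (score p θ x) * inner ℝ w (score p θ x) ∂(law ν p θ) := by
  have hcoord : ∀ i x, inner ℝ (EuclideanSpace.single i (1 : ℝ)) (score p θ x) =
      score p θ x i := fun i x => by simp [EuclideanSpace.inner_single_left]
  have hfisher : ∀ i j, fisher ν p θ i j = ∫ x, score p θ x i * score p θ x j ∂(law ν p θ) := by
    intro i j
    rw [integral_law hmodel hθ, fisher, Matrix.of_apply]
    congr 1
    ext x
    simp only [score, dDensity]
    by_cases h : p θ x = 0
    · simp [h]
    · field_simp
  have hint : ∀ i j, Integrable (fun x => score p θ x i * score p θ x j) (law ν p θ) := by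
    intro i j
    have hi := hL2 (EuclideanSpace.single i 1)
    have hj := hL2 (EuclideanSpace.single j 1)
    simp only [hcoord] at hi hj
    exact hi.integrable_mul hj
  have hexp : ∀ x, inner ℝ v (score p θ x) * inner ℝ w (score p θ x) =
      ∑ i, ∑ j, v i * w j * (score p θ x i * score p θ x j) := fun x => by
    simp only [PiLp.inner_apply, Finset.sum_mul_sum]
    refine Finset.sum_congr rfl fun i _ => Finset.sum_congr rfl fun j _ => ?_
    simp
    ring
  simp only [hexp]
  rw [integral_finsetSum _ fun i _ => integrable_finsetSum _ fun j _ => (hint i j).const_mul _]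
  simp only [dotProduct, Matrix.mulVec, Finset.mul_sum]
  refine Finset.sum_congr rfl fun i _ => ?_
  rw [integral_finsetSum _ fun j _ => (hint i j).const_mul _]
  refine Finset.sum_congr rfl fun j _ => ?_
  rw [integral_const_mul, hfisher]
  ring

lemma posSemidef_fisher (hmodel : IsModel φ ν Θ p) (hθ : θ ∈ Θ)
    (hL2 : ∀ v, MemLp (fun x => inner ℝ v (score p θ x)) 2 (law ν p θ)) :
    (fisher ν p θ).PosSemidef := by
  refine Matrix.PosSemidef.of_dotProduct_mulVec_nonneg ?_ fun v => ?_
  · ext i j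
    simp [fisher, mul_comm]
  · have := dotProduct_fisher_mulVec hmodel hθ hL2 (WithLp.toLp 2 v) (WithLp.toLp 2 v)
    simp only [star_trivial]
    rw [this]
    exact integral_nonneg fun x => mul_self_nonneg _

end Local

end PhiDiv

/-! ### Linear algebra of the saddle form -/

/-- In finite dimension, a symmetric bilinear form is small as soon as its quadratic form is small
at finitely many suitable points. -/
lemma exists_finset_norm_lt_of_symm {V : Type*} [NormedAddCommGroup V] [NormedSpace ℝ V]
    [FiniteDimensional ℝ V] {η : ℝ} (hη : 0 < η) : ∃ τ > 0, ∃ T : Finset V,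
      ∀ B : V →L[ℝ] V →L[ℝ] ℝ, (∀ x y, B x y = B y x) → (∀ z ∈ T, |B z z| < τ) → ‖B‖ < η := by
  classical
  let b := Module.finBasis ℝ V
  let f : (V →L[ℝ] V →L[ℝ] ℝ) →ₗ[ℝ] (Fin (Module.finrank ℝ V) × Fin (Module.finrank ℝ V) → ℝ) :=
    { toFun := fun B ij => B (b ij.1) (b ij.2)
      map_add' := fun _ _ => rfl
      map_smul' := fun _ _ => rfl }
  -- The entries on a basis determine the form; an injective linear map on a finite-dimensional
  -- space is bounded below.
  obtain ⟨K, hK, hf⟩ := LinearMap.exists_antilipschitzWith (𝕜 := ℝ)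
    (E := V →L[ℝ] V →L[ℝ] ℝ)
    (F := Fin (Module.finrank ℝ V) × Fin (Module.finrank ℝ V) → ℝ) f (LinearMap.ker_eq_bot'.2 fun B hB => by
    refine ContinuousLinearMap.coe_injective (b.ext fun i => ?_)
    refine ContinuousLinearMap.coe_injective (b.ext fun j => ?_)
    exact congrFun hB (i, j))
  have hK' : (0 : ℝ) < K := hK
  -- Polarization 2B(x, y) = B(x+y, x+y) − B(x, x) − B(y, y) bounds each entry by 2τ = η/(2K), hence
  -- ‖B‖ by η/2.
  refine ⟨η / (4 * K), by positivity, Finset.univ.image b ∪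
    Finset.univ.image (fun ij : _ × _ => b ij.1 + b ij.2), fun B hsymm hB => ?_⟩
  have hle : ‖f B‖ ≤ η / (2 * K) := by
    refine (pi_norm_le_iff_of_nonneg (by positivity)).2 fun ij => ?_
    have h1 := abs_lt.1 (hB (b ij.1) (by simp))
    have h2 := abs_lt.1 (hB (b ij.2) (by simp))
    have h3 := abs_lt.1 (hB (b ij.1 + b ij.2) (by simp))
    simp only [map_add, add_apply, hsymm (b ij.2) (b ij.1)] at h3
    have e : η / (2 * K) = 2 * (η / (4 * K)) := by field_simp; norm_num
    change |B (b ij.1) (b ij.2)| ≤ _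
    rw [abs_le, e]
    constructor <;> linarith [h1.1, h1.2, h2.1, h2.2, h3.1, h3.2]
  have h : ‖B‖ ≤ K * ‖f B‖ := by
    have h := hf.le_mul_dist B 0
    rw [map_zero, dist_zero_right (f B)] at h
    exact (dist_zero_right B).symm.le.trans h
  calc ‖B‖ ≤ K * ‖f B‖ := h
    _ ≤ K * (η / (2 * K)) := by gcongr
    _ = η / 2 := by field_simp
    _ < η := by linarith

/-- The block diagonal form `(z, z') ↦ c (⟪T z₁, z'₁⟫ - ⟪T z₂, z'₂⟫)`. -/
noncomputable def blockForm {E : Type*} [NormedAddCommGroup E] [InnerProductSpace ℝ E] (c : ℝ)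
    (T : E →L[ℝ] E) : E × E →L[ℝ] E × E →L[ℝ] ℝ :=
  c • ((innerSL ℝ).bilinearComp (T.comp (ContinuousLinearMap.fst ℝ E E))
      (ContinuousLinearMap.fst ℝ E E) -
    (innerSL ℝ).bilinearComp (T.comp (ContinuousLinearMap.snd ℝ E E))
      (ContinuousLinearMap.snd ℝ E E))

section BlockForm

variable {E : Type*} [NormedAddCommGroup E] [InnerProductSpace ℝ E] {c : ℝ} {T : E →L[ℝ] E}

lemma blockForm_apply (z z' : E × E) :
    blockForm c T z z' = c * (inner ℝ (T z.1) z'.1 - inner ℝ (T z.2) z'.2) := rfl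

/-- The form has no cross term, so v drops out of the second block. This is the nondegeneracy
required by `fderiv_eq_zero_of_minimax`. -/
lemma mul_norm_le_norm_blockForm_comp_inr {κ : ℝ} (hκ : ∀ v, κ * ‖v‖ ≤ ‖T v‖) (v w : E) :
    |c| * κ * ‖w‖ ≤ ‖(blockForm c T (v, w)).comp (ContinuousLinearMap.inr ℝ E E)‖ := by
  have h : (blockForm c T (v, w)).comp (ContinuousLinearMap.inr ℝ E E) =
      (-c) • innerSL ℝ (T w) := by
    ext w'
    simp [blockForm_apply]
  rw [h, norm_smul, innerSL_apply_norm, norm_neg, Real.norm_eq_abs, mul_assoc]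
  exact mul_le_mul_of_nonneg_left (hκ w) (abs_nonneg c)

/-- A point at which an approximately linear stationarity equation holds is close to the solution
of the linear equation, relative to the size of the latter. -/
lemma norm_sub_le_of_norm_blockForm_le {κ ρ : ℝ} (hc : c ≠ 0) (hκ0 : 0 < κ)
    (hκ : ∀ v, κ * ‖v‖ ≤ ‖T v‖) (hρ0 : 0 ≤ ρ)
    (hρ : ρ ≤ 1 / 2) {Ψ : E × E →L[ℝ] ℝ} {y : E}
    (hΨ : ∀ v w, Ψ (v, w) = -(c * inner ℝ (v - w) (T y))) {δ : E × E}
    (h : ‖Ψ + blockForm c T δ‖ ≤ |c| * κ * ρ * ‖δ‖) :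
    ‖δ.1 - y‖ ≤ 2 * ρ * ‖y‖ ∧ ‖δ.2 - y‖ ≤ 2 * ρ * ‖y‖ := by
  have hc' : 0 < |c| := abs_pos.2 hc
  have haux : ∀ x : E, |c| * ‖T (x - y)‖ * ‖T (x - y)‖ ≤ |c| * κ * ρ * ‖δ‖ * ‖T (x - y)‖ →
      ‖x - y‖ ≤ ρ * ‖δ‖ := fun x hx => by
    rcases (norm_nonneg (T (x - y))).eq_or_lt with h0 | h0
    · have h1 := hκ (x - y)
      rw [← h0] at h1
      have h2 : ‖x - y‖ ≤ 0 := nonpos_of_mul_nonpos_right h1 hκ0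
      exact h2.trans (by positivity)
    · have h1 := le_of_mul_le_mul_right hx h0
      have h2 := mul_le_mul_of_nonneg_left (hκ (x - y)) hc'.le
      have h3 : |c| * κ * ‖x - y‖ ≤ |c| * κ * (ρ * ‖δ‖) := by linarith
      exact le_of_mul_le_mul_left h3 (by positivity)
  have h1 : ‖δ.1 - y‖ ≤ ρ * ‖δ‖ := haux δ.1 (by
    -- At this test vector the left side is exactly c‖T(δ.1 − y)‖². The second block is treated
    -- likewise, with the opposite sign.
    have h1 := ContinuousLinearMap.le_of_opNorm_le _ h (T (δ.1 - y), 0)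
    have e : (Ψ + blockForm c T δ) (T (δ.1 - y), 0) = c * (‖T (δ.1 - y)‖ * ‖T (δ.1 - y)‖) := by
      rw [add_apply, hΨ, blockForm_apply, ← real_inner_self_eq_norm_mul_norm]
      conv_rhs => rw [map_sub, inner_sub_left, ← map_sub]
      simp only [sub_zero, inner_zero_right, real_inner_comm (T y)]
      ring
    rw [e, norm_mul, Real.norm_eq_abs, Real.norm_eq_abs, abs_mul_self] at h1
    simpa [mul_assoc] using h1)
  have h2 : ‖δ.2 - y‖ ≤ ρ * ‖δ‖ := haux δ.2 (by
    have h1 := ContinuousLinearMap.le_of_opNorm_le _ h (0, T (δ.2 - y))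
    have e : (Ψ + blockForm c T δ) (0, T (δ.2 - y)) = -c * (‖T (δ.2 - y)‖ * ‖T (δ.2 - y)‖) := by
      rw [add_apply, hΨ, blockForm_apply, ← real_inner_self_eq_norm_mul_norm]
      conv_rhs => rw [map_sub, inner_sub_left, ← map_sub]
      simp only [zero_sub, inner_zero_right, inner_neg_right, real_inner_comm (T y)]
      ring
    rw [e, norm_mul, Real.norm_eq_abs, Real.norm_eq_abs, abs_mul_self, abs_neg] at h1
    simpa [mul_assoc] using h1)
  have h3 : ‖δ‖ ≤ ‖y‖ + ρ * ‖δ‖ := by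
    refine max_le ?_ ?_
    · linarith [norm_le_norm_add_norm_sub' δ.1 y]
    · linarith [norm_le_norm_add_norm_sub' δ.2 y]
  have h4 : ρ * ‖δ‖ ≤ 2 * ρ * ‖y‖ := by
    -- Since ρ ≤ 1/2, the term ρ‖δ‖ is absorbed, and the error becomes relative to ‖y‖ instead of
    -- ‖δ‖.
    have h5 : ‖δ‖ ≤ 2 * ‖y‖ := by linarith [mul_le_mul_of_nonneg_right hρ (norm_nonneg δ)]
    linarith [mul_le_mul_of_nonneg_left h5 hρ0]
  exact ⟨h1.trans h4, h2.trans h4⟩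

end BlockForm

/-! ### Derivatives of empirical means -/

lemma hasFDerivAt_mean {V W : Type*} [NormedAddCommGroup V] [NormedSpace ℝ V]
    [NormedAddCommGroup W] [NormedSpace ℝ W] {f : ℕ → V → W} {z : V}
    (hf : ∀ i, DifferentiableAt ℝ (f i) z) (n : ℕ) :
    HasFDerivAt (fun z => (n : ℝ)⁻¹ • ∑ i ∈ Finset.range n, f i z)
      ((n : ℝ)⁻¹ • ∑ i ∈ Finset.range n, fderiv ℝ (f i) z) z :=
  (HasFDerivAt.fun_sum fun i _ => (hf i).hasFDerivAt).const_smul ((n : ℝ)⁻¹)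

lemma norm_mean_sub_mean_le {W : Type*} [NormedAddCommGroup W] [NormedSpace ℝ W] {f g : ℕ → W}
    {C : ℕ → ℝ} {r : ℝ} (h : ∀ i, ‖f i - g i‖ ≤ C i * r) (n : ℕ) :
    ‖(n : ℝ)⁻¹ • ∑ i ∈ Finset.range n, f i - (n : ℝ)⁻¹ • ∑ i ∈ Finset.range n, g i‖ ≤
      ((n : ℝ)⁻¹ * ∑ i ∈ Finset.range n, C i) * r := by
  rw [← smul_sub, ← Finset.sum_sub_distrib, norm_smul, norm_inv, Real.norm_natCast, mul_assoc,
    Finset.sum_mul]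
  gcongr
  exact norm_sum_le_of_le _ fun i _ => h i

/-- The derivative of a mean of functions with Lipschitz second derivatives is close to a linear
map `S` on a small ball if its derivative at the center is. -/
lemma norm_mean_fderiv_sub_sub_le {V : Type*} [NormedAddCommGroup V] [NormedSpace ℝ V]
    {f : ℕ → V → ℝ} {u : V} {ε : ℝ} {C : ℕ → ℝ} {n : ℕ} {S : V →L[ℝ] V →L[ℝ] ℝ} {η K : ℝ}
    (hf : ∀ i, ∀ z ∈ Metric.ball u ε, DifferentiableAt ℝ (fderiv ℝ (f i)) z)
    (hlip : ∀ i, ∀ z ∈ Metric.ball u ε,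
      ‖fderiv ℝ (fderiv ℝ (f i)) z - fderiv ℝ (fderiv ℝ (f i)) u‖ ≤ C i * ‖z - u‖)
    (hC : (n : ℝ)⁻¹ * ∑ i ∈ Finset.range n, C i ≤ K) (hK : 0 ≤ K)
    (hS : ‖(n : ℝ)⁻¹ • ∑ i ∈ Finset.range n, fderiv ℝ (fderiv ℝ (f i)) u - S‖ ≤ η - K * ε)
    {z z' : V} (hz : z ∈ Metric.ball u ε) (hz' : z' ∈ Metric.ball u ε) :
    ‖(n : ℝ)⁻¹ • ∑ i ∈ Finset.range n, fderiv ℝ (f i) z -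
      (n : ℝ)⁻¹ • ∑ i ∈ Finset.range n, fderiv ℝ (f i) z' - S (z - z')‖ ≤ η * ‖z - z'‖ := by
  refine norm_sub_sub_apply_le_of_norm_hasFDerivAt_sub_le (convex_ball u ε)
    (Ψ := fun z => (n : ℝ)⁻¹ • ∑ i ∈ Finset.range n, fderiv ℝ (f i) z)
    (fun z hz => hasFDerivAt_mean (fun i => hf i z hz) n) (fun z hz => ?_) hz hz'
  have h1 := norm_mean_sub_mean_le (W := V →L[ℝ] V →L[ℝ] ℝ)
    (f := fun i => fderiv ℝ (fderiv ℝ (f i)) z) (g := fun i => fderiv ℝ (fderiv ℝ (f i)) u)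
    (fun i => hlip i z hz) n
  have h2 : ((n : ℝ)⁻¹ * ∑ i ∈ Finset.range n, C i) * ‖z - u‖ ≤ K * ε := by
    gcongr
    rw [← dist_eq_norm]
    exact (Metric.mem_ball.1 hz).le
  refine (norm_sub_le_norm_sub_add_norm_sub _
    ((n : ℝ)⁻¹ • ∑ i ∈ Finset.range n, fderiv ℝ (fderiv ℝ (f i)) u) _).trans ?_
  linarith

lemma inner_toEuclideanCLM {d : ℕ} (A : Matrix (Fin d) (Fin d) ℝ) (x y : EuclideanSpace ℝ (Fin d)) :
    inner ℝ (Matrix.toEuclideanCLM (𝕜 := ℝ) A x) y = y.ofLp ⬝ᵥ A.mulVec x.ofLp := by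
  rw [EuclideanSpace.inner_eq_star_dotProduct]
  simp

/-! ### Uniform linearization of the empirical criterion -/

namespace PhiDiv

variable {d : ℕ} {𝒳 Ω : Type*} [MeasurableSpace 𝒳] [MeasurableSpace Ω] {φ : ℝ → ℝ≥0∞}
  {ν : Measure 𝒳} {Θ : Set (EuclideanSpace ℝ (Fin d))} {p : EuclideanSpace ℝ (Fin d) → 𝒳 → ℝ}
  {N : Set (EuclideanSpace ℝ (Fin d))} {θ : EuclideanSpace ℝ (Fin d)} {μ : Measure Ω}
  {X : ℕ → Ω → 𝒳}

/-- The empirical criterion has a derivative that is close to the linear map given by the Fisher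
information, locally uniformly. -/
lemma exists_eventuallyLikely_empirical (hφ : IsGenerator φ) (hφ2 : deriv (dphi φ) 1 ≠ 0)
    (hmodel : IsModel φ ν Θ p) (hN : IsOpen N) (hNΘ : N ⊆ Θ)
    (hD1 : DominatedDeriv 1 (fun θ α x => fFun φ p θ α x * p θ x) N ν)
    (hD2 : DominatedDeriv 2 (fun θ α x => fFun φ p θ α x * p θ x) N ν)
    (hD3 : DominatedDeriv 3 (hFun φ ν p) N (law ν p θ)) (hθ : θ ∈ N)
    (hL2 : ∀ v, MemLp (fun x => inner ℝ v (score p θ x)) 2 (law ν p θ))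
    [IsProbabilityMeasure μ] (hX : ∀ i, Measurable (X i)) (hindep : iIndepFun X μ)
    (hlaw : ∀ i, μ.map (X i) = law ν p θ) {η : ℝ} (hη : 0 < η) :
    ∃ ε > 0, Metric.ball (θ, θ) ε ⊆ N ×ˢ N ∧ EventuallyLikely μ fun n ω =>
      ∃ Ψ : EuclideanSpace ℝ (Fin d) × EuclideanSpace ℝ (Fin d) →
          EuclideanSpace ℝ (Fin d) × EuclideanSpace ℝ (Fin d) →L[ℝ] ℝ,
        (∀ z ∈ Metric.ball (θ, θ) ε, HasFDerivAt
          (fun z : _ × _ => empH φ ν p n (fun i => X i ω) z.1 z.2) (Ψ z) z) ∧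
        (∀ z ∈ Metric.ball (θ, θ) ε, ∀ z' ∈ Metric.ball (θ, θ) ε,
          ‖Ψ z - Ψ z' - blockForm (deriv (dphi φ) 1)
            (Matrix.toEuclideanCLM (𝕜 := ℝ) (fisher ν p θ)) (z - z')‖ ≤ η * ‖z - z'‖) ∧
        ∀ v w, Ψ (θ, θ) (v, w) = -(deriv (dphi φ) 1 *
          inner ℝ (v - w) ((n : ℝ)⁻¹ • ∑ i ∈ Finset.range n, score p θ (X i ω))) := by
  classical
  have hθΘ := hNΘ hθ
  set c := deriv (dphi φ) 1 with hc
  set T := Matrix.toEuclideanCLM (𝕜 := ℝ) (fisher ν p θ) with hT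
  obtain ⟨G, hG, hD⟩ := hD3.three
  obtain ⟨τ, hτ, Z, hZ⟩ := exists_finset_norm_lt_of_symm
    (V := EuclideanSpace ℝ (Fin d) × EuclideanSpace ℝ (Fin d)) (half_pos hη)
  obtain ⟨r, hr, hball⟩ := Metric.isOpen_iff.1 (hN.prod hN) (θ, θ) ⟨hθ, hθ⟩
  -- The empirical mean of the Lipschitz constants is likely below K. On a ball of radius at most
  -- η/(2K) the second derivative then varies by at most η/2; the other η/2 is allowed for the error
  -- at the center.
  set K := |∫ x, G x ∂(law ν p θ)| + 1 with hK
  have hK0 : 0 < K := by positivity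
  have hinner : ∀ v w, inner ℝ (T v) w =
      ∫ x, inner ℝ v (score p θ x) * inner ℝ w (score p θ x) ∂(law ν p θ) := fun v w => by
    rw [hT, inner_toEuclideanCLM, dotProduct_fisher_mulVec hmodel hθΘ hL2]
    simp only [mul_comm]
  have hsymm : ∀ x y, blockForm c T x y = blockForm c T y x := fun x y => by
    simp only [blockForm_apply, hinner, mul_comm]
  refine ⟨min r (η / (2 * K)), lt_min hr (by positivity),
    (Metric.ball_subset_ball (min_le_left _ _)).trans hball, ?_⟩
  have hfirst : ∀ᵐ x ∂(law ν p θ), fderiv ℝ (fun u => hPair φ ν p u x) (θ, θ) =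
      (-c) • (innerSL ℝ (score p θ x)).comp
        (ContinuousLinearMap.fst ℝ _ _ - ContinuousLinearMap.snd ℝ _ _) := by
    -- The formula holds almost surely for each direction; finitely many basis directions give an
    -- almost sure equality of linear maps.
    let b := Module.finBasis ℝ (EuclideanSpace ℝ (Fin d) × EuclideanSpace ℝ (Fin d))
    filter_upwards [ae_all_iff.2 fun i =>
      (derivs_hPair hφ hφ2 hmodel hN hNΘ hD1 hD2 hD3 hθ (b i).1 (b i).2).1] with x hx
    refine ContinuousLinearMap.coe_injective (b.ext fun i => ?_)
    have h := hx i
    rw [Prod.mk.eta] at h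
    simp [h, real_inner_comm (score p θ x), hc, inner_sub_right]
  have hgood : ∀ᵐ ω ∂μ, ∀ i, _ ∧ _ := ae_all_iff.2 fun i =>
    ae_of_ae_map (hX i).aemeasurable (by rw [hlaw i]; exact hD.and hfirst)
  -- The expected second derivative is known through its quadratic form only, so the law of large
  -- numbers is applied at the finitely many test points that control a symmetric form.
  have hquad : EventuallyLikely μ fun n ω => ∀ z : Z, |(n : ℝ)⁻¹ * ∑ i ∈ Finset.range n,
      fderiv ℝ (fderiv ℝ fun u => hPair φ ν p u (X i ω)) (θ, θ) z z - blockForm c T z z| < τ := by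
    refine EventuallyLikely.forall_finite fun z => ?_
    have h := (derivs_hPair hφ hφ2 hmodel hN hNΘ hD1 hD2 hD3 hθ z.1.1 z.1.2).2 hL2
    refine (EventuallyLikely.abs_mean_sub_lt hX hindep hlaw h.1 hτ).mono
      (Eventually.of_forall fun n ω hω => ?_)
    rw [h.2] at hω
    convert! hω using 3
    simp only [blockForm_apply, hinner, sq, hc]
  refine ((EventuallyLikely.of_ae hgood).and (hquad.and
    (EventuallyLikely.abs_mean_sub_lt hX hindep hlaw hG one_pos))).mono
    (Eventually.of_forall fun n ω hω => ?_)
  obtain ⟨hω, hquadω, hGω⟩ := hω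
  have hmem : ∀ z ∈ Metric.ball (θ, θ) (min r (η / (2 * K))), z ∈ N ×ˢ N := fun z hz =>
    hball (Metric.ball_subset_ball (min_le_left _ _) hz)
  have hcz : (θ, θ) ∈ Metric.ball (θ, θ) (min r (η / (2 * K))) :=
    Metric.mem_ball_self (lt_min hr (by positivity))
  have hcenter : ‖(n : ℝ)⁻¹ • ∑ i ∈ Finset.range n,
      fderiv ℝ (fderiv ℝ fun u => hPair φ ν p u (X i ω)) (θ, θ) - blockForm c T‖ < η / 2 := by
    refine hZ _ (fun x y => ?_) fun z hz => ?_
    · simp only [sub_apply, smul_apply, sum_apply, hsymm x y]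
      congr 2
      refine Finset.sum_congr rfl fun i _ => ?_
      refine second_derivative_symmetric_of_eventually_of_real
        (f := fun u => hPair φ ν p u (X i ω)) ?_
        ((hω i).1.2.1 (θ, θ) ⟨hθ, hθ⟩).hasFDerivAt x y
      exact Filter.eventually_of_mem ((hN.prod hN).mem_nhds ⟨hθ, hθ⟩)
        fun u hu => ((hω i).1.1 u hu).hasFDerivAt
    · simpa using hquadω ⟨z, hz⟩
  refine ⟨fun z => (n : ℝ)⁻¹ • ∑ i ∈ Finset.range n,
    fderiv ℝ (fun u => hPair φ ν p u (X i ω)) z, fun z hz => ?_, fun z hz z' hz' => ?_, fun v w => ?_⟩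
  · exact hasFDerivAt_mean (f := fun i u => hPair φ ν p u (X i ω))
      (fun i => (hω i).1.1 z (hmem z hz)) n
  · refine norm_mean_fderiv_sub_sub_le (f := fun i u => hPair φ ν p u (X i ω))
      (C := fun i => G (X i ω)) (K := K) (fun i z hz => (hω i).1.2.1 z (hmem z hz))
      (fun i z hz => (hω i).1.2.2 _ hmem (convex_ball _ _) z hz _ hcz) ?_ hK0.le ?_ hz hz'
    · have := (abs_lt.1 hGω).2
      linarith [le_abs_self (∫ x, G x ∂(law ν p θ))]
    · have h1 : K * min r (η / (2 * K)) ≤ K * (η / (2 * K)) := by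
        gcongr; exact min_le_right _ _
      have h2 : K * (η / (2 * K)) = η / 2 := by field_simp
      linarith
  · simp only [smul_apply, sum_apply, (hω _).2]
    simp only [ContinuousLinearMap.comp_apply, sub_apply, ContinuousLinearMap.coe_fst',
      ContinuousLinearMap.coe_snd', innerSL_apply_apply, inner_smul_right, inner_sum, smul_eq_mul,
      real_inner_comm (v - w), ← Finset.mul_sum]
    ring

end PhiDiv

/-! ### Central limit theorem for the score, and comparison of minimax values -/

namespace PhiDiv

variable {d : ℕ} {𝒳 Ω : Type*} [MeasurableSpace 𝒳] [MeasurableSpace Ω] {φ : ℝ → ℝ≥0∞}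
  {ν : Measure 𝒳} {Θ : Set (EuclideanSpace ℝ (Fin d))} {p : EuclideanSpace ℝ (Fin d) → 𝒳 → ℝ}
  {θ : EuclideanSpace ℝ (Fin d)} {μ : Measure Ω} {X : ℕ → Ω → 𝒳}

/-- The central limit theorem for the normalized sums of the scores. -/
lemma tendstoInDistribution_score (hmodel : IsModel φ ν Θ p) (hθ : θ ∈ Θ)
    (hL2 : ∀ v, MemLp (fun x => inner ℝ v (score p θ x)) 2 (law ν p θ))
    (hmean : ∀ v, ∫ x, inner ℝ v (score p θ x) ∂(law ν p θ) = 0)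
    (hdet : (fisher ν p θ).det ≠ 0)
    [IsProbabilityMeasure μ] (hX : ∀ i, Measurable (X i)) (hindep : iIndepFun X μ)
    (hlaw : ∀ i, μ.map (X i) = law ν p θ) :
    TendstoInDistribution (fun (n : ℕ) ω => (√n)⁻¹ • ∑ i ∈ Finset.range n,
      Matrix.toEuclideanCLM (𝕜 := ℝ) (fisher ν p θ)⁻¹ (score p θ (X i ω))) atTop id
      (fun _ => μ) (multivariateGaussian 0 (fisher ν p θ)⁻¹) := by
  have hscore : AEMeasurable (score p θ) (law ν p θ) := by
    refine (WithLp.measurable_toLp 2 _).comp_aemeasurable (aemeasurable_pi_iff.2 fun i => ?_)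
    have h := (hL2 (EuclideanSpace.single i 1)).aestronglyMeasurable.aemeasurable
    simpa only [inner_score] using h
  set T := Matrix.toEuclideanCLM (𝕜 := ℝ) (fisher ν p θ)⁻¹ with hT
  have hY : ∀ i, AEMeasurable (fun x => T (score p θ x)) (μ.map (X i)) := fun i => by
    rw [hlaw i]; exact T.continuous.measurable.comp_aemeasurable hscore
  have hpsd := posSemidef_fisher hmodel hθ hL2
  have hherm : (fisher ν p θ)⁻¹.transpose = (fisher ν p θ)⁻¹ := by
    simpa [Matrix.IsHermitian] using hpsd.inv.isHermitian
  have hadj : ∀ t x, inner ℝ t (T x) = inner ℝ (T t) x := fun t x => by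
    rw [hT, real_inner_comm, inner_toEuclideanCLM, inner_toEuclideanCLM,
      Matrix.dotProduct_mulVec, ← Matrix.mulVec_transpose, hherm, dotProduct_comm]
  have hsub : ∀ (g : 𝒳 → ℝ), AEStronglyMeasurable g (law ν p θ) →
      ∫ ω, g (X 0 ω) ∂μ = ∫ x, g x ∂(law ν p θ) := fun g hg => by
    rw [← hlaw 0, integral_map (hX 0).aemeasurable (by rwa [hlaw 0])]
  refine tendstoInDistribution_inv_sqrt_smul_sum_multivariateGaussian hpsd.inv
    (hindep.comp₀ (fun _ x => T (score p θ x)) (fun i => (hX i).aemeasurable) hY)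
    (fun i => IdentDistrib.comp_of_aemeasurable (u := fun x => T (score p θ x))
      ⟨(hX i).aemeasurable, (hX 0).aemeasurable, by rw [hlaw, hlaw]⟩ (hY i))
    (fun t => ?_) (fun t => ?_) (fun t => ?_)
  · simp only [hadj]
    have h := hL2 (T t)
    rw [← hlaw 0] at h
    exact h.comp_of_map (hX 0).aemeasurable
  · simp only [hadj]
    rw [hsub _ (hL2 (T t)).aestronglyMeasurable, hmean]
  · simp only [hadj]
    rw [hsub (fun x => inner ℝ (T t) (score p θ x) ^ 2) (hL2 (T t)).integrable_sq.aestronglyMeasurable]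
    simp only [sq]
    rw [← dotProduct_fisher_mulVec hmodel hθ hL2]
    -- The variance is ⟨I⁻¹t, I I⁻¹t⟩ = ⟨I⁻¹t, t⟩.
    have : (T t).ofLp = (fisher ν p θ)⁻¹.mulVec t.ofLp := by simp [hT]
    rw [this, Matrix.mulVec_mulVec, Matrix.mul_nonsing_inv _ (isUnit_iff_ne_zero.2 hdet),
      Matrix.one_mulVec, dotProduct_comm]

/-- At a minimax point that is locally attained, the values of the criterion can be compared. -/
lemma IsMinMaxEstimate.empH_le {n : ℕ} {x : ℕ → 𝒳} {θ₀ θ₁ α₀ α₁ : EuclideanSpace ℝ (Fin d)}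
    (h : IsMinMaxEstimate φ ν Θ p n x θ₀) (hθ₁ : θ₁ ∈ Θ)
    (h₀ : IsDualEstimate φ ν Θ p n x θ₀ α₀) (h₁ : IsDualEstimate φ ν Θ p n x θ₁ α₁) :
    empH φ ν p n x θ₀ α₀ ≤ empH φ ν p n x θ₁ α₁ := by
  rw [← EReal.coe_le_coe_iff]
  calc (empH φ ν p n x θ₀ α₀ : EReal) ≤ ⨆ α ∈ Θ, (empH φ ν p n x θ₀ α : EReal) :=
        le_iSup₂ (f := fun α (_ : α ∈ Θ) => (empH φ ν p n x θ₀ α : EReal)) α₀ h₀.1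
    _ ≤ ⨆ α ∈ Θ, (empH φ ν p n x θ₁ α : EReal) := h.2 θ₁ hθ₁
    _ ≤ _ := iSup₂_le fun α hα => EReal.coe_le_coe_iff.2 (h₁.2 α hα)

end PhiDiv

/-! ### Conclusion -/

open PhiDiv in
theorem mainTheorem1 {d : ℕ} {𝒳 Ω : Type*} [MeasurableSpace 𝒳] [MeasurableSpace Ω]
    (φ : ℝ → ℝ≥0∞) (hφ : PhiDiv.IsGenerator φ) (hφ2 : deriv (PhiDiv.dphi φ) 1 ≠ 0)
    (ν : Measure 𝒳) [SigmaFinite ν]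
    (Θ : Set (EuclideanSpace ℝ (Fin d))) (p : EuclideanSpace ℝ (Fin d) → 𝒳 → ℝ)
    (hmodel : PhiDiv.IsModel φ ν Θ p)
    (θT : EuclideanSpace ℝ (Fin d)) (hθT : θT ∈ interior Θ)
    (μ : Measure Ω) [IsProbabilityMeasure μ] (X : ℕ → Ω → 𝒳)
    (hXmeas : ∀ i, Measurable (X i)) (hXindep : iIndepFun X μ)
    (hXlaw : ∀ i, μ.map (X i) = PhiDiv.law ν p θT)
    (θhat : ℕ → Ω → EuclideanSpace ℝ (Fin d))
    (αhat : ℕ → Ω → EuclideanSpace ℝ (Fin d) → EuclideanSpace ℝ (Fin d))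
    (hθmeas : ∀ n, AEMeasurable (θhat n) μ)
    (hαmeas : ∀ n, AEMeasurable (fun ω => αhat n ω (θhat n ω)) μ)
    (hA4 : PhiDiv.ConsistentEstimates φ ν Θ p μ X θT θhat αhat)
    (hA5 : PhiDiv.DominationCondition φ ν Θ p θT)
    (hA6 : PhiDiv.MomentCondition φ ν p θT) :
    TendstoInDistribution (fun (n : ℕ) ω => Real.sqrt n • (θhat n ω - θT)) atTop id
        (fun _ => μ) (multivariateGaussian 0 (PhiDiv.fisher ν p θT)⁻¹) ∧
      TendstoInDistribution (fun (n : ℕ) ω => Real.sqrt n • (αhat n ω (θhat n ω) - θT)) atTop id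
        (fun _ => μ) (multivariateGaussian 0 (PhiDiv.fisher ν p θT)⁻¹) := by
  obtain ⟨N, hN, hθN, hNΘ, hD1, hD2, hD3⟩ := hA5
  have hL2 := memLp_inner_score hφ hφ2 hmodel hN hNΘ hD1 hD2 hD3 hθN hA6.d_alpha
  have hclt := tendstoInDistribution_score hmodel (hNΘ hθN) hL2
    (integral_inner_score hφ hφ2 hmodel hN hNΘ hD1 hθN) hA6.fisher_det hXmeas hXindep hXlaw
  set c := deriv (dphi φ) 1 with hc
  set I := fisher ν p θT with hI
  have hunit : IsUnit I.det := isUnit_iff_ne_zero.2 hA6.fisher_det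
  set T := Matrix.toEuclideanCLM (𝕜 := ℝ) I with hT
  set J := Matrix.toEuclideanCLM (𝕜 := ℝ) I⁻¹ with hJ
  have hTJ : ∀ v, T (J v) = v := fun v => by
    rw [← mul_apply_eq_comp, hT, hJ, ← map_mul, Matrix.mul_nonsing_inv _ hunit, map_one,
      one_apply_eq_self]
  have hJT : ∀ v, J (T v) = v := fun v => by
    rw [← mul_apply_eq_comp, hT, hJ, ← map_mul, Matrix.nonsing_inv_mul _ hunit, map_one,
      one_apply_eq_self]
  obtain ⟨κ, hκ0, hκ⟩ : ∃ κ > 0, ∀ v, κ * ‖v‖ ≤ ‖T v‖ := by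
    -- The summand 1 covers J = 0, which occurs when d = 0.
    refine ⟨(‖J‖ + 1)⁻¹, by positivity, fun v => ?_⟩
    rw [inv_mul_le_iff₀ (by positivity)]
    have h := J.le_opNorm (T v)
    rw [hJT] at h
    linarith [norm_nonneg (T v)]
  have hc0 : 0 < |c| := abs_pos.2 hφ2
  set Z : ℕ → Ω → EuclideanSpace ℝ (Fin d) := fun n ω => (√n)⁻¹ • ∑ i ∈ Finset.range n,
    J (score p θT (X i ω)) with hZ
  have hrel : ∀ η > 0, EventuallyLikely μ fun n ω =>
      ‖Real.sqrt n • (θhat n ω - θT) - Z n ω‖ ≤ η * ‖Z n ω‖ ∧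
      ‖Real.sqrt n • (αhat n ω (θhat n ω) - θT) - Z n ω‖ ≤ η * ‖Z n ω‖ := by
    intro η hη
    -- The bound 1/2 allows absorption and keeps |c|κρ strictly below |c|κ for the minimax lemma;
    -- the bound η/2 turns the final error 2ρ‖y‖ into at most η‖y‖.
    set ρ := min (1 / 2) (η / 2) with hρ
    have hρ0 : 0 < ρ := lt_min (by norm_num) (by positivity)
    obtain ⟨ε, hε, hball, hΨ⟩ := exists_eventuallyLikely_empirical hφ hφ2 hmodel hN hNΘ hD1 hD2 hD3
      hθN hL2 hXmeas hXindep hXlaw (η := |c| * κ * ρ) (by positivity)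
    obtain ⟨δ, hδ, hα⟩ := hA4.consistent_alpha ε hε
    have hθ := EventuallyLikely.of_tendstoInMeasure hA4.consistent_theta (lt_min hδ hε)
    refine ((EventuallyLikely.and hA4.exists_theta hα).and (hΨ.and hθ)).mono
      (Eventually.of_forall fun n ω h => ?_)
    obtain ⟨⟨hmin, hdual⟩, ⟨Ψ, hder, hlin, hcenter⟩, hclose⟩ := h
    have hsub : ∀ θ ∈ Metric.ball θT (min δ ε), θ ∈ Θ ∧ dist θ θT < δ := fun θ hθ => by
      refine ⟨hNΘ ?_, (Metric.mem_ball.1 hθ).trans_le (min_le_left _ _)⟩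
      have : (θ, θT) ∈ Metric.ball (θT, θT) ε := by
        rw [← ball_prod_same]
        exact ⟨Metric.ball_subset_ball (min_le_right _ _) hθ, Metric.mem_ball_self hε⟩
      exact (hball this).1
    have hsubα : ∀ α ∈ Metric.ball θT ε, α ∈ Θ := fun α hα => by
      have : (θT, α) ∈ Metric.ball (θT, θT) ε := by
        rw [← ball_prod_same]
        exact ⟨Metric.mem_ball_self hε, hα⟩
      exact hNΘ (hball this).2
    have hθmem : θhat n ω ∈ Metric.ball θT (min δ ε) := by
      rw [Metric.mem_ball, dist_eq_norm]; exact hclose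
    have hd := fun θ hθ => hdual θ (hsub θ hθ).1 (hsub θ hθ).2
    have hρle : ρ ≤ 1 / 2 := min_le_left _ _
    have hcrit := fderiv_eq_zero_of_minimax (a := αhat n ω) (θ₁ := θhat n ω)
      (κ := |c| * κ) (min_le_right δ ε) (by
        have : 0 < |c| * κ := by positivity
        nlinarith) hder hlin (mul_norm_le_norm_blockForm_comp_inr hκ)
      (fun θ hθ => (hd θ hθ).2) (fun θ hθ α hα => (hd θ hθ).1.2 α (hsubα α hα)) hθmem
      (fun θ hθ => hmin.empH_le (hsub θ hθ).1 (hd _ hθmem).1 (hd θ hθ).1)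
    have hmem : (θhat n ω, αhat n ω (θhat n ω)) ∈ Metric.ball (θT, θT) ε := by
      rw [← ball_prod_same]
      exact ⟨Metric.ball_subset_ball (min_le_right _ _) hθmem, (hd _ hθmem).2⟩
    -- The linearization between the critical point and the center is the approximate equation Ψ(θT,
    -- θT) + S δ ≈ 0 for the displacement δ.
    have h1 := hlin _ hmem _ (Metric.mem_ball_self hε)
    rw [hcrit, zero_sub, ← neg_add', norm_neg] at h1
    set y := (n : ℝ)⁻¹ • ∑ i ∈ Finset.range n, J (score p θT (X i ω)) with hy
    have hTy : T y = (n : ℝ)⁻¹ • ∑ i ∈ Finset.range n, score p θT (X i ω) := by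
      simp only [hy, map_smul, map_sum, hTJ]
    have h2 := norm_sub_le_of_norm_blockForm_le hφ2 hκ0 hκ hρ0.le hρle
      (fun v w => by rw [hTy]; exact hcenter v w) h1
    have hZy : Z n ω = √n • y := by
      simp only [hZ, hy, smul_smul]
      congr 1
      -- For n = 0 both sides vanish by the convention 0⁻¹ = 0.
      rcases Nat.eq_zero_or_pos n with rfl | hn
      · simp
      · have : (0 : ℝ) < n := Nat.cast_pos.2 hn
        rw [inv_eq_iff_eq_inv, mul_inv, inv_inv, inv_mul_eq_div, Real.div_sqrt]
    have h3 : 2 * ρ ≤ η := by linarith [min_le_right (1 / 2 : ℝ) (η / 2)]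
    have h4 : ∀ x : EuclideanSpace ℝ (Fin d), ‖x - y‖ ≤ 2 * ρ * ‖y‖ →
        ‖√n • x - Z n ω‖ ≤ η * ‖Z n ω‖ := fun x hx => by
      rw [hZy, ← smul_sub, norm_smul, norm_smul, mul_left_comm]
      refine mul_le_mul_of_nonneg_left (hx.trans ?_) (norm_nonneg _)
      exact mul_le_mul_of_nonneg_right h3 (norm_nonneg _)
    exact ⟨h4 _ h2.1, h4 _ h2.2⟩
  exact ⟨EventuallyLikely.tendstoInDistribution_of_relative_error hclt
      (fun n => ((hθmeas n).sub_const θT).const_smul (√n))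
      fun η hη => (hrel η hη).mono (Eventually.of_forall fun n ω h => h.1),
    EventuallyLikely.tendstoInDistribution_of_relative_error hclt
      (fun n => ((hαmeas n).sub_const θT).const_smul (√n))
      fun η hη => (hrel η hη).mono (Eventually.of_forall fun n ω h => h.2)⟩
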